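/- **Setting.** Let $d\ge 1$. All max-stable processes $X=\{X_t\}_{t\in\mathbb R^d}$ have standard Fréchet marginals, $\mathbb P(X_t\le x)=e^{-1/x}$ for $x>0$. The tail correlation function (TCF) of a stationary process $X$ is $\chi(t)=\lim_{\tau\to\infty}\mathbb P(X_t\ge\tau\mid X_o\ge\tau)$, $t\in\mathbb R^d$, provided that the limit exists for every $t$. A process has spectral functions $V_t\ge 0$ on a measure space $(S,\nu)$, where $\int V_t\,d\nu=1$ for all $t$, if it has the law of $\sup_n U_nV_t(\omega_n)$, where $(U_n,\omega_n)$ are the points of a Poisson process on $(0,\infty)\times S$ with intensity $u^{-2}du\times\nu(d\omega)$; equivalently, $-\log\mathbb P(X_{t_k}\le x_k,\ k\le m)=\int\max_k V_{t_k}/x_k\,d\nu$ for all $t_1,\dots,t_m\in\mathbb R^d$ and $x_1,\dots,x_m>0$. * $T^d_r$ is the set of continuous radial functions on $\mathbb R^d$ that are the TCF of some stationary max-stable process on $\mathbb R^d$, are convex in the radius on $[0,\infty)$, and vanish at infinity. * $T^d_{\rm VBR}$ is the set of TCFs of variance-mixed Brown–Resnick processes on $\mathbb R^d$. These have spectral functions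 $V_t=\exp\big(SW_t-\tfrac12 S^2\operatorname{Var}(W_t)\big)$ on a probability space, where $W$ is a centred Gaussian process on $\mathbb R^d$ with stationary increments and $S$ is a random variable with values in $(0,\infty)$ that is independent of $W$. * $T^d_{\rm M3r}$ is the set of TCFs of M3r processes on $\mathbb R^d$. These have spectral functions $V_t(z,f)=f(t-z)$ with respect to $\nu=\text{Lebesgue measure}\times\text{law of }f$, where $f$ is a random measurable $[0,\infty]$-valued function on $\mathbb R^d$ with $\mathbb E\int_{\mathbb R^d}f=1$, each realization of which is radially symmetric and non-increasing in the radius. Let $h_1(s)=(1-|s|)_+$ for $s\in\mathbb R$ and let $\varphi_d(x)=\int_{S^{d-1}}h_1(\langle u,x\rangle)\,\sigma(du)$ for $x\in\mathbb R^d$, where $\sigma$ is the uniform probability distribution on the unit sphere $S^{d-1}$. This function is radial and is also written $\varphi_d(\|x\|)$. Further let $$h_d(t)=\frac{d\,\Gamma(d/2)}{\sqrt\pi\,\Gamma((d+1)/2)}\int_t^1(1-v^2)_+^{(d-1)/2}\,dv\quad(0\le t\le1),\qquad h_d(t)=0\quad(t>1),$$ and let $\chi_d(t)=\varphi_d(2t)\,h_d(t)$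 for $t\ge0$, viewed as the radial function $x\mapsto\chi_d(\|x\|)$ on $\mathbb R^d$. **Proposition 4.10.** (a) For every $d\ge1$, $\chi_d\in T^d_r\setminus T^d_{\rm VBR}$. (b) For $d=3$, $\chi_3\in T^3_r\setminus\big(T^3_{\rm VBR}\cup T^3_{\rm M3r}\big)$. -/

import Mathlib

open MeasureTheory ProbabilityTheory Filter Topology
open scoped ENNReal

namespace MaxStableTCF

noncomputable section

/-- The Euclidean space `ℝ^d`. -/
abbrev Space (d : ℕ) : Type := EuclideanSpace ℝ (Fin d)

/-! ## Processes on `ℝ^d` and their tail correlation functions -/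

section Processes

variable {d : ℕ} {Ω : Type} [MeasurableSpace Ω]

/-- `X` is stationary: its finite-dimensional distributions are translation invariant. -/
def IsStationaryProcess (P : Measure Ω) (X : Space d → Ω → ℝ) : Prop :=
  ∀ (m : ℕ) (t : Fin m → Space d) (h : Space d),
    P.map (fun ω k => X (t k + h) ω) = P.map (fun ω k => X (t k) ω)

/-- `X` is max-stable: for all `m`, all `n ≥ 1` and all `t₁, …, t_m`, the componentwise maximum
of `n` independent copies of `Y = (X_{t₁}, …, X_{t_m})` has the law of `a Y + b` for suitable
`a, b ∈ ℝ^m` with `a > 0`. -/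
def IsMaxStableProcess (P : Measure Ω) (X : Space d → Ω → ℝ) : Prop :=
  ∀ (m : ℕ) (t : Fin m → Space d) (n : ℕ), 1 ≤ n →
    ∃ a b : Fin m → ℝ, (∀ k, 0 < a k) ∧
      (Measure.pi (fun _ : Fin n => P.map (fun ω k => X (t k) ω))).map
          (fun (y : Fin n → Fin m → ℝ) (k : Fin m) => ⨆ i : Fin n, y i k)
        = P.map (fun ω k => a k * X (t k) ω + b k)

/-- All one-dimensional marginals of `X` are standard Fréchet. -/
def HasFrechetMarginals (P : Measure Ω) (X : Space d → Ω → ℝ) : Prop :=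
  ∀ (t : Space d) (x : ℝ), 0 < x → P.real {ω | X t ω ≤ x} = Real.exp (-1 / x)

/-- `χ` is the tail correlation function of the process `X` with standard Fréchet marginals
(whose upper endpoint is `∞`): `χ t = lim_{τ → ∞} P (X_t ≥ τ | X_0 ≥ τ)` for all `t`. -/
def HasTCF (P : Measure Ω) (X : Space d → Ω → ℝ) (χ : Space d → ℝ) : Prop :=
  ∀ t : Space d,
    Tendsto (fun τ : ℝ => (ProbabilityTheory.cond P {ω | τ ≤ X 0 ω}).real {ω | τ ≤ X t ω})
      atTop (𝓝 (χ t))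

/-- `X` has the law of the process `sup_n U_n V_t(ω_n)`, where `(U_n, ω_n)` are the points of a
Poisson point process on `(0,∞) × S` with intensity `u⁻² du × ν(dω)` and where the `V_t ≥ 0` are
measurable with `∫ V_t dν = 1`. The law is given by its finite-dimensional distributions
`-log P (X_{t_k} ≤ x_k, k = 1, …, m) = ∫ max_k V_{t_k}(ω) / x_k ν(dω)`, for `x_k > 0`. -/
structure HasSpectralRepresentation (P : Measure Ω) (X : Space d → Ω → ℝ)
    {S : Type} [MeasurableSpace S] (ν : Measure S) (V : Space d → S → ℝ≥0∞) : Prop where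
  measurable (t : Space d) : Measurable (V t)
  lintegral_eq_one (t : Space d) : ∫⁻ s, V t s ∂ν = 1
  fdd (m : ℕ) (t : Fin m → Space d) (x : Fin m → ℝ) (hx : ∀ k, 0 < x k) :
    P.real {ω | ∀ k, X (t k) ω ≤ x k} =
      Real.exp (-(∫⁻ s, ⨆ k, V (t k) s / ENNReal.ofReal (x k) ∂ν).toReal)

/-! ## M3r and VBR processes -/

/-- `X` is an M3r process: a mixed moving maxima process (spectral functions
`V_t (z, f) = f (t - z)` on `ℝ^d × F` with the measure `Lebesgue × law of f`) whose random shape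
function `f` is a measurable process with values in `[0,∞]` such that `E ∫ f = 1` and such that
each of its realizations is radially symmetric and non-increasing in the radius. -/
def IsM3rProcess (P : Measure Ω) (X : Space d → Ω → ℝ) : Prop :=
  ∃ (F : Type) (_ : MeasurableSpace F) (Q : Measure F) (_ : IsProbabilityMeasure Q)
    (f : F → Space d → ℝ≥0∞),
    Measurable (fun p : F × Space d => f p.1 p.2) ∧
    (∀ (φ : F) (x y : Space d), ‖x‖ ≤ ‖y‖ → f φ y ≤ f φ x) ∧
    ∫⁻ φ, ∫⁻ x, f φ x ∂volume ∂Q = 1 ∧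
    HasSpectralRepresentation P X ((volume : Measure (Space d)).prod Q)
      (fun t p => f p.2 (t - p.1))

/-- `W` has stationary increments: the law of `(W_{t+h} - W_h)_t` does not depend on `h`. -/
def HasStationaryIncrements (P : Measure Ω) (W : Space d → Ω → ℝ) : Prop :=
  ∀ (m : ℕ) (t : Fin m → Space d) (h h' : Space d),
    P.map (fun ω k => W (t k + h) ω - W h ω) = P.map (fun ω k => W (t k + h') ω - W h' ω)

/-- `X` is a variance-mixed Brown-Resnick process: its spectral process is
`V_t = exp (S W_t - S² Var(W_t) / 2)`, where `W` is a centred Gaussian process with stationary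
increments and `S` is a random variable on `(0,∞)` that is independent of `W`. -/
def IsVBRProcess (P : Measure Ω) (X : Space d → Ω → ℝ) : Prop :=
  ∃ (Ω' : Type) (_ : MeasurableSpace Ω') (Q : Measure Ω') (_ : IsProbabilityMeasure Q)
    (W : Space d → Ω' → ℝ) (S : Ω' → ℝ),
    (∀ t, Measurable (W t)) ∧ Measurable S ∧
    IsGaussianProcess W Q ∧ (∀ t, ∫ ω, W t ω ∂Q = 0) ∧ HasStationaryIncrements Q W ∧
    (∀ ω, 0 < S ω) ∧ IndepFun S (fun ω t => W t ω) Q ∧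
    HasSpectralRepresentation P X Q
      (fun t ω => ENNReal.ofReal
        (Real.exp (S ω * W t ω - S ω ^ 2 * variance (W t) Q / 2)))

end Processes

/-! ## Classes of tail correlation functions -/

/-- The set `T^d` of all tail correlation functions of stationary max-stable processes with
standard Fréchet marginals on `ℝ^d`. -/
def allTCF (d : ℕ) : Set (Space d → ℝ) :=
  {χ | ∃ (Ω : Type) (_ : MeasurableSpace Ω) (P : Measure Ω) (_ : IsProbabilityMeasure P)
      (X : Space d → Ω → ℝ),
      (∀ t, Measurable (X t)) ∧ IsStationaryProcess P X ∧ IsMaxStableProcess P X ∧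
      HasFrechetMarginals P X ∧ HasTCF P X χ}

/-- The set `T^d_M3r` of tail correlation functions of M3r processes on `ℝ^d`. -/
def m3rTCF (d : ℕ) : Set (Space d → ℝ) :=
  {χ | ∃ (Ω : Type) (_ : MeasurableSpace Ω) (P : Measure Ω) (_ : IsProbabilityMeasure P)
      (X : Space d → Ω → ℝ),
      (∀ t, Measurable (X t)) ∧ IsM3rProcess P X ∧ HasTCF P X χ}

/-- The set `T^d_VBR` of tail correlation functions of VBR processes on `ℝ^d`. -/
def vbrTCF (d : ℕ) : Set (Space d → ℝ) :=
  {χ | ∃ (Ω : Type) (_ : MeasurableSpace Ω) (P : Measure Ω) (_ : IsProbabilityMeasure P)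
      (X : Space d → Ω → ℝ),
      (∀ t, Measurable (X t)) ∧ IsVBRProcess P X ∧ HasTCF P X χ}

/-- The set `T^d_r` of continuous radial tail correlation functions on `ℝ^d` that are convex in
the radius and vanish at infinity. -/
def radialTCF (d : ℕ) : Set (Space d → ℝ) :=
  {χ | χ ∈ allTCF d ∧ Continuous χ ∧
      ∃ c : ℝ → ℝ, (∀ x, χ x = c ‖x‖) ∧ ConvexOn ℝ (Set.Ici 0) c ∧ Tendsto c atTop (𝓝 0)}

/-! ## The function `χ_d` -/

/-- The tent function `h₁(t) = (1 - |t|)₊` on `ℝ`. -/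
def tent (t : ℝ) : ℝ := max (1 - |t|) 0

/-- The turning bands operator from `ℝ` to `ℝ^d`: `f` is averaged over the projections `⟨u, x⟩`,
where `u` is uniformly distributed on the unit sphere of `ℝ^d`. -/
def turningBands (d : ℕ) (f : ℝ → ℝ) (x : Space d) : ℝ :=
  ⨍ u : Metric.sphere (0 : Space d) 1, f (inner ℝ (u : Space d) x)
    ∂((volume : Measure (Space d)).toSphere)

/-- `φ_d`, the image of the tent function under the turning bands operator. -/
def phi (d : ℕ) : Space d → ℝ := turningBands d tent

/-- The function `h_d` on `[0,∞)`,
`h_d(t) = d Γ(d/2) / (√π Γ((d+1)/2)) ∫_t^1 (1 - v²)₊^{(d-1)/2} dv`, which is `0` for `t ≥ 1`. -/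
def hFun (d : ℕ) (t : ℝ) : ℝ :=
  d * Real.Gamma (d / 2) / (Real.sqrt Real.pi * Real.Gamma ((d + 1) / 2)) *
    ∫ v in Set.Ioc t 1, (1 - v ^ 2) ^ (((d : ℝ) - 1) / 2)

/-- The function `χ_d(t) = φ_d(2t) h_d(t)`, as a radial function on `ℝ^d`. -/
def chi (d : ℕ) (x : Space d) : ℝ := phi d ((2 : ℝ) • x) * hFun d ‖x‖

end

end MaxStableTCF

namespace MaxStableTCF

open scoped Pointwise

/-! ### Laws on `ℝ^m` determined by their distribution functions -/

/-! Everything passes through spectral functions. If `X` is represented by `V` on `ν`, then `P(X_0 <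
τ, X_t < τ) = exp(-τ⁻¹ ∫ max(V_0, V_t) dν)`. Since `max + min` integrates to 2, the limit defining
the tail correlation function is `∫ min(V_0, V_t) dν` (`HasSpectralRepresentation.hasTCF`). Each
claim becomes a statement about this integral.

Membership. A mark consists of a uniform direction `u`, a point of the line and a point of space.
Let `V_t` be a constant times the indicator that `t` lies both in the slab orthogonal to `u` of
thickness 1/2 at that position on the line and in the ball of radius 1/2 about that point of space.
For fixed `u` the overlap of the conditions for `0` and `t` is a product, an interval overlap times
a ball overlap; averaging over `u` turns it into `φ_d(2t) h_d(t)` (`lintegral_min_markSpectral`).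
Translations of space act on the marks and preserve their measure, which gives stationarity. The
process itself is built from a Poisson process of marks (`exists_process`), and max-stability is the
homogeneity of the exponent. In the radius both factors of `χ_d` are nonnegative, nonincreasing and
convex, hence so is their product.

Not VBR. Exponential spectral functions are strictly positive, so a VBR tail correlation function
vanishes nowhere (`pos_of_mem_vbrTCF`), while `χ_d` is zero outside the unit ball.

Not M3r when `d = 3`. The superlevel sets of a radial nonincreasing shape are balls up to null sets,
or the whole space. By the layer-cake formula an M3r tail correlation function is therefore a
mixture of volumes of intersections of two equal balls. In dimension three such a volume is
proportional to `2s³ - 3s²τ + τ³` for distance `τ` up to the diameter `s`, so its second derivative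
divided by `τ` is a constant up to `s` and zero beyond. Nonincreasing behaviour of `χ''(τ)/τ`
survives mixing and is used as an inequality between second differences (`m3rTCF_inequality`). But
`φ_3(2r)` is `1 - r` up to `r = 1/2` and `1/(4r)` after it, so `χ_3''` jumps upwards at 1/2;
differences centred at 0.49 and 0.51 detect the jump. -/

theorem measure_ext_of_Iic {m : ℕ} {μ ν : Measure (Fin m → ℝ)} [IsProbabilityMeasure μ]
    [IsProbabilityMeasure ν] (h : ∀ x, μ (Set.Iic x) = ν (Set.Iic x)) : μ = ν := by
  have hspan : IsCountablySpanning (Set.range (Set.Iic : ℝ → Set ℝ)) := by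
    refine ⟨fun n : ℕ => Set.Iic (n : ℝ), fun n => ⟨_, rfl⟩, ?_⟩
    refine Set.eq_univ_of_forall fun x => ?_
    obtain ⟨n, hn⟩ := exists_nat_ge x
    exact Set.mem_iUnion.2 ⟨n, hn⟩
  refine ext_of_generate_finite
    (Set.pi Set.univ '' Set.pi Set.univ fun _ : Fin m => Set.range (Set.Iic : ℝ → Set ℝ))
    (generateFrom_eq_pi (fun _ => ?_) fun _ => hspan).symm
    (IsPiSystem.pi fun _ => isPiSystem_Iic) ?_ (by simp)
  · rw [← borel_eq_generateFrom_Iic, BorelSpace.measurable_eq (α := ℝ)]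
  · rintro _ ⟨s, hs, rfl⟩
    choose x hx using fun k => hs k (Set.mem_univ k)
    have : Set.pi Set.univ s = Set.Iic x := by
      rw [← Set.pi_univ_Iic]
      congr 1
      exact (funext hx).symm
    rw [this, h]

/-- A spectral representation prescribes distribution functions only at positive thresholds. This
suffices, because a box with a nonpositive corner coordinate is null for both laws. -/
theorem measure_ext_of_Iic_of_pos {m : ℕ} {μ ν : Measure (Fin m → ℝ)} [IsProbabilityMeasure μ]
    [IsProbabilityMeasure ν] (hμ : ∀ k, μ {y | y k ≤ 0} = 0) (hν : ∀ k, ν {y | y k ≤ 0} = 0)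
    (h : ∀ x : Fin m → ℝ, (∀ k, 0 < x k) → μ (Set.Iic x) = ν (Set.Iic x)) : μ = ν := by
  refine measure_ext_of_Iic fun x => ?_
  by_cases hx : ∀ k, 0 < x k
  · exact h x hx
  · push Not at hx
    obtain ⟨k, hk⟩ := hx
    have hsub : Set.Iic x ⊆ {y | y k ≤ 0} := fun y hy => (hy k).trans hk
    rw [measure_mono_null hsub (hμ k), measure_mono_null hsub (hν k)]

/-! ### Consequences of a spectral representation -/

namespace HasSpectralRepresentation

variable {d : ℕ} {Ω : Type} [MeasurableSpace Ω] {P : Measure Ω}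
  {X : Space d → Ω → ℝ} {S : Type} [MeasurableSpace S] {ν : Measure S} {V : Space d → S → ℝ≥0∞}

theorem hasFrechetMarginals (h : HasSpectralRepresentation P X ν V) : HasFrechetMarginals P X := by
  intro t x hx
  have h1 := h.fdd 1 (fun _ => t) (fun _ => x) (fun _ => hx)
  simp only [forall_const, ciSup_const] at h1
  rw [h1]
  simp only [div_eq_mul_inv]
  rw [lintegral_mul_const _ (h.measurable t), h.lintegral_eq_one, one_mul, ENNReal.toReal_inv,
    ENNReal.toReal_ofReal hx.le]
  congr 1
  ring

theorem measure_le_zero [IsProbabilityMeasure P]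
    (h : HasSpectralRepresentation P X ν V) (t : Space d) :
    P {ω | X t ω ≤ 0} = 0 := by
  rw [← measureReal_eq_zero_iff]
  have hlim : Tendsto (fun x : ℝ => Real.exp (-1 / x)) (𝓝[>] 0) (𝓝 0) := by
    refine Real.tendsto_exp_atBot.comp ?_
    refine Tendsto.congr (fun x => (div_eq_mul_inv (-1 : ℝ) x).symm) ?_
    exact tendsto_inv_nhdsGT_zero.const_mul_atTop_of_neg (by norm_num)
  refine le_antisymm (ge_of_tendsto hlim ?_) measureReal_nonneg
  filter_upwards [self_mem_nhdsWithin] with x hx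
  rw [← h.hasFrechetMarginals t x hx]
  exact measureReal_mono fun ω (hω : X t ω ≤ 0) => hω.trans (le_of_lt hx)

/-- The exponent is homogeneous of degree -1 in the thresholds. Max-stability and the continuity of
the distribution functions both rest on this. -/
theorem lintegral_iSup_div_mul {m : ℕ} (t : Fin m → Space d) (x : Fin m → ℝ) {c : ℝ} (hc : 0 < c) :
    ∫⁻ s, ⨆ k, V (t k) s / ENNReal.ofReal (c * x k) ∂ν =
      (ENNReal.ofReal c)⁻¹ * ∫⁻ s, ⨆ k, V (t k) s / ENNReal.ofReal (x k) ∂ν := by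
  rw [← lintegral_const_mul' _ _ (by simp [hc])]
  refine lintegral_congr fun s => ?_
  rw [ENNReal.mul_iSup]
  refine iSup_congr fun k => ?_
  rw [ENNReal.ofReal_mul hc.le, div_eq_mul_inv, div_eq_mul_inv,
    ENNReal.mul_inv (Or.inl (by simp [hc])) (Or.inl ENNReal.ofReal_ne_top)]
  ring

theorem fdd_mul (h : HasSpectralRepresentation P X ν V) {m : ℕ} (t : Fin m → Space d)
    (x : Fin m → ℝ) (hx : ∀ k, 0 < x k) {c : ℝ} (hc : 0 < c) :
    P.real {ω | ∀ k, X (t k) ω ≤ c * x k} =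
      Real.exp (-(c⁻¹ * (∫⁻ s, ⨆ k, V (t k) s / ENNReal.ofReal (x k) ∂ν).toReal)) := by
  rw [h.fdd m t _ (fun k => mul_pos hc (hx k)), lintegral_iSup_div_mul t x hc, ENNReal.toReal_mul,
    ENNReal.toReal_inv, ENNReal.toReal_ofReal hc.le]

/-- The complement of `{τ ≤ X_t}` is a strict inequality, so the tail correlation needs this form.
By homogeneity the distribution function is continuous along rays, and `c ↑ 1` closes the gap
between `<` and `≤`. -/
theorem fdd_lt [IsProbabilityMeasure P]
    (h : HasSpectralRepresentation P X ν V) {m : ℕ} (t : Fin m → Space d)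
    (x : Fin m → ℝ) (hx : ∀ k, 0 < x k) :
    P.real {ω | ∀ k, X (t k) ω < x k} =
      Real.exp (-(∫⁻ s, ⨆ k, V (t k) s / ENNReal.ofReal (x k) ∂ν).toReal) := by
  set θ := (∫⁻ s, ⨆ k, V (t k) s / ENNReal.ofReal (x k) ∂ν).toReal with hθ
  apply le_antisymm
  · rw [hθ, ← h.fdd m t x hx]
    exact measureReal_mono fun ω hω k => (hω k).le
  · have hlim : Tendsto (fun c : ℝ => Real.exp (-(c⁻¹ * θ))) (𝓝[<] 1) (𝓝 (Real.exp (-θ))) := by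
      have : ContinuousAt (fun c : ℝ => Real.exp (-(c⁻¹ * θ))) 1 := by
        fun_prop (disch := norm_num)
      simpa using this.tendsto.mono_left (nhdsWithin_le_nhds (s := Set.Iio 1))
    refine le_of_tendsto hlim ?_
    have h0 : ∀ᶠ c : ℝ in 𝓝[<] 1, 0 < c := nhdsWithin_le_nhds (lt_mem_nhds one_pos)
    filter_upwards [self_mem_nhdsWithin, h0] with c hc hc0
    rw [hθ, ← h.fdd_mul t x hx hc0]
    refine measureReal_mono fun ω hω k => (hω k).trans_lt ?_
    have := hx k
    have : c < 1 := hc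
    nlinarith

theorem map_isProbabilityMeasure [IsProbabilityMeasure P]
    (hX : ∀ t, Measurable (X t)) {m : ℕ} (t : Fin m → Space d) :
    IsProbabilityMeasure (P.map fun ω k => X (t k) ω) :=
  Measure.isProbabilityMeasure_map (measurable_pi_lambda _ fun k => hX (t k)).aemeasurable

theorem map_le_zero [IsProbabilityMeasure P]
    (h : HasSpectralRepresentation P X ν V) (hX : ∀ t, Measurable (X t)) {m : ℕ}
    (t : Fin m → Space d) (k : Fin m) : (P.map fun ω k => X (t k) ω) {y | y k ≤ 0} = 0 := by
  rw [Measure.map_apply (measurable_pi_lambda _ fun k => hX (t k))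
    (measurableSet_le (measurable_pi_apply k) measurable_const)]
  exact h.measure_le_zero (t k)

theorem map_Iic (hX : ∀ t, Measurable (X t)) {m : ℕ} (t : Fin m → Space d) (x : Fin m → ℝ) :
    (P.map fun ω k => X (t k) ω) (Set.Iic x) = P {ω | ∀ k, X (t k) ω ≤ x k} := by
  rw [Measure.map_apply (measurable_pi_lambda _ fun k => hX (t k)) measurableSet_Iic]
  rfl

theorem maxStable [IsProbabilityMeasure P]
    (h : HasSpectralRepresentation P X ν V) (hX : ∀ t, Measurable (X t)) :
    IsMaxStableProcess P X := by
  intro m t n hn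
  have hn0 : (0 : ℝ) < n := by exact_mod_cast hn
  have : Nonempty (Fin n) := ⟨⟨0, hn⟩⟩
  -- The maximum of `n` copies has distribution function `exp(-nθ(x)) = exp(-θ(x/n))`, so it is
  -- scaled by `n` with no shift.
  refine ⟨fun _ => n, fun _ => 0, fun _ => hn0, ?_⟩
  simp only [add_zero]
  set μ := P.map fun ω k => X (t k) ω with hμ
  have : IsProbabilityMeasure μ := map_isProbabilityMeasure hX t
  have hsup : Measurable fun (y : Fin n → Fin m → ℝ) (k : Fin m) => ⨆ i : Fin n, y i k :=
    measurable_pi_lambda _ fun k => Measurable.iSup fun i =>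
      (measurable_pi_apply k).comp (measurable_pi_apply i)
  have hscale : Measurable fun ω (k : Fin m) => (n : ℝ) * X (t k) ω :=
    measurable_pi_lambda _ fun k => (hX (t k)).const_mul _
  have hle : ∀ (y : Fin n → Fin m → ℝ) k (b : ℝ), ⨆ i, y i k ≤ b ↔ ∀ i, y i k ≤ b := fun y k b =>
    ciSup_le_iff (Set.finite_range _).bddAbove
  have := Measure.isProbabilityMeasure_map (μ := Measure.pi fun _ : Fin n => μ) hsup.aemeasurable
  have := Measure.isProbabilityMeasure_map (μ := P) hscale.aemeasurable
  refine measure_ext_of_Iic_of_pos (fun k => ?_) (fun k => ?_) fun x hx => ?_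
  · rw [Measure.map_apply hsup (measurableSet_le (measurable_pi_apply k) measurable_const)]
    have : (fun (y : Fin n → Fin m → ℝ) (k : Fin m) => ⨆ i : Fin n, y i k) ⁻¹' {y | y k ≤ 0} =
        Set.pi Set.univ fun _ => {z | z k ≤ 0} := by
      ext y
      simp [hle]
    rw [this, Measure.pi_pi, h.map_le_zero hX t k]
    simp [Nat.one_le_iff_ne_zero.1 hn]
  · rw [Measure.map_apply hscale (measurableSet_le (measurable_pi_apply k) measurable_const)]
    have : (fun ω (k : Fin m) => (n : ℝ) * X (t k) ω) ⁻¹' {y | y k ≤ 0} = {ω | X (t k) ω ≤ 0} := by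
      ext ω
      simp [mul_nonpos_iff, hn0.not_ge]
    rw [this, h.measure_le_zero]
  · rw [Measure.map_apply hsup measurableSet_Iic, Measure.map_apply hscale measurableSet_Iic]
    have h1 : (fun (y : Fin n → Fin m → ℝ) (k : Fin m) => ⨆ i : Fin n, y i k) ⁻¹' Set.Iic x =
        Set.pi Set.univ fun _ => Set.Iic x := by
      ext y
      simp only [Set.mem_preimage, Set.mem_Iic, Pi.le_def, hle, Set.mem_pi, Set.mem_univ,
        forall_const]
      exact forall_comm
    have h2 : (fun ω (k : Fin m) => (n : ℝ) * X (t k) ω) ⁻¹' Set.Iic x =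
        {ω | ∀ k, X (t k) ω ≤ (n : ℝ)⁻¹ * x k} := by
      ext ω
      simp only [Set.mem_preimage, Set.mem_Iic, Pi.le_def, Set.mem_ofPred_eq]
      exact forall_congr' fun k => (le_inv_mul_iff₀ hn0).symm
    rw [h1, Measure.pi_pi, h2, hμ, map_Iic hX, ← ENNReal.toReal_eq_toReal_iff' (by simp) (by simp),
      Finset.prod_const, Finset.card_univ, Fintype.card_fin, ENNReal.toReal_pow]
    change P.real _ ^ n = P.real _
    rw [h.fdd m t x hx, h.fdd_mul t x hx (inv_pos.2 hn0), ← Real.exp_nat_mul, inv_inv]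
    congr 1
    ring

theorem stationary [IsProbabilityMeasure P]
    (h : HasSpectralRepresentation P X ν V) (hX : ∀ t, Measurable (X t))
    (hV : ∀ (m : ℕ) (t : Fin m → Space d) (r : Space d) (x : Fin m → ℝ), (∀ k, 0 < x k) →
      ∫⁻ s, ⨆ k, V (t k + r) s / ENNReal.ofReal (x k) ∂ν =
        ∫⁻ s, ⨆ k, V (t k) s / ENNReal.ofReal (x k) ∂ν) :
    IsStationaryProcess P X := by
  intro m t r
  have := map_isProbabilityMeasure (P := P) hX t
  have := map_isProbabilityMeasure (P := P) hX fun k => t k + r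
  refine measure_ext_of_Iic_of_pos (h.map_le_zero hX fun k => t k + r) (h.map_le_zero hX t)
    fun x hx => ?_
  rw [map_Iic hX fun k => t k + r, map_Iic hX,
    ← ENNReal.toReal_eq_toReal_iff' (by simp) (by simp)]
  change P.real _ = P.real _
  rw [h.fdd m _ x hx, h.fdd m t x hx, hV m t r x hx]

theorem lintegral_max_add_lintegral_min (h : HasSpectralRepresentation P X ν V) (s t : Space d) :
    ∫⁻ ω, max (V s ω) (V t ω) ∂ν + ∫⁻ ω, min (V s ω) (V t ω) ∂ν = 2 := by
  rw [← lintegral_add_left ((h.measurable s).max (h.measurable t))]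
  simp only [max_add_min]
  rw [lintegral_add_left (h.measurable s), h.lintegral_eq_one, h.lintegral_eq_one]
  norm_num

theorem measureReal_pair_lt [IsProbabilityMeasure P]
    (h : HasSpectralRepresentation P X ν V) (s t : Space d) {τ : ℝ}
    (hτ : 0 < τ) : P.real {ω | X s ω < τ ∧ X t ω < τ} =
      Real.exp (-(τ⁻¹ * (∫⁻ ω, max (V s ω) (V t ω) ∂ν).toReal)) := by
  have h1 := h.fdd_lt ![s, t] ![τ, τ] (by simp [Fin.forall_fin_two, hτ])
  have hset : {ω | ∀ k, X (![s, t] k) ω < ![τ, τ] k} = {ω | X s ω < τ ∧ X t ω < τ} := by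
    ext ω
    simp [Fin.forall_fin_two]
  have hint : ∀ ω, ⨆ k, V (![s, t] k) ω / ENNReal.ofReal (![τ, τ] k) =
      (ENNReal.ofReal τ)⁻¹ * max (V s ω) (V t ω) := by
    intro ω
    rw [(Monotone.map_max (fun a b hab => by gcongr) :
      (ENNReal.ofReal τ)⁻¹ * max (V s ω) (V t ω) = _)]
    refine le_antisymm (iSup_le ?_) (max_le ?_ ?_)
    · simp [Fin.forall_fin_two, div_eq_mul_inv, mul_comm]
    · exact le_iSup_of_le 0 (by simp [div_eq_mul_inv, mul_comm])
    · exact le_iSup_of_le 1 (by simp [div_eq_mul_inv, mul_comm])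
  rw [hset] at h1
  rw [h1]
  simp only [hint]
  rw [lintegral_const_mul' _ _ (by simp [hτ]), ENNReal.toReal_mul, ENNReal.toReal_inv,
    ENNReal.toReal_ofReal hτ.le]

/-- With `u = 1/τ` and `θ = ∫ max(V_0, V_t)`, inclusion-exclusion gives the conditional probability
as `2 - (1 - e^(-uθ))/(1 - e^(-u))`. As `u ↓ 0` the quotient tends to `θ`, and `2 - θ` is the
integral of the minimum. -/
theorem hasTCF [IsProbabilityMeasure P]
    (h : HasSpectralRepresentation P X ν V) (hX : ∀ t, Measurable (X t)) :
    HasTCF P X fun t => (∫⁻ ω, min (V 0 ω) (V t ω) ∂ν).toReal := by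
  intro t
  set θ := (∫⁻ ω, max (V 0 ω) (V t ω) ∂ν).toReal with hθ
  have hsum := h.lintegral_max_add_lintegral_min 0 t
  have hmax : ∫⁻ ω, max (V 0 ω) (V t ω) ∂ν ≠ ∞ := fun hc => by simp [hc] at hsum
  have hmin : ∫⁻ ω, min (V 0 ω) (V t ω) ∂ν ≠ ∞ := fun hc => by simp [hc] at hsum
  have hval : (∫⁻ ω, min (V 0 ω) (V t ω) ∂ν).toReal = 2 - θ := by
    have := congrArg ENNReal.toReal hsum
    rw [ENNReal.toReal_add hmax hmin] at this
    simp only [ENNReal.toReal_ofNat] at this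
    linarith
  change Tendsto _ _ (𝓝 (∫⁻ ω, min (V 0 ω) (V t ω) ∂ν).toReal)
  rw [hval]
  have hslope : ∀ a : ℝ, Tendsto (fun u : ℝ => (1 - Real.exp (-(u * a))) / u) (𝓝[>] 0) (𝓝 a) := by
    intro a
    have hd : HasDerivAt (fun u : ℝ => 1 - Real.exp (-(u * a))) a 0 := by
      have := ((((hasDerivAt_id (0 : ℝ)).mul_const a).neg).exp).const_sub 1
      simpa using this
    have := (hasDerivAt_iff_tendsto_slope.1 hd).mono_left
      (nhdsWithin_mono (0 : ℝ) (fun x (hx : 0 < x) => ne_of_gt hx))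
    refine this.congr fun u => ?_
    simp [slope_def_field]
  have hratio : Tendsto (fun u : ℝ => 2 - (1 - Real.exp (-(u * θ))) / (1 - Real.exp (-(u * 1))))
      (𝓝[>] 0) (𝓝 (2 - θ)) := by
    have := ((hslope θ).div (hslope 1) one_ne_zero).const_sub 2
    rw [div_one] at this
    refine this.congr' ?_
    filter_upwards [self_mem_nhdsWithin] with u (hu : 0 < u)
    simp only [Pi.div_apply]
    rw [div_div_div_cancel_right₀ hu.ne']
  refine (hratio.comp tendsto_inv_atTop_nhdsGT_zero).congr' ?_
  filter_upwards [eventually_gt_atTop 0] with τ hτ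
  have hm0 : MeasurableSet {ω | τ ≤ X 0 ω} := measurableSet_le measurable_const (hX 0)
  have hlt : ∀ s, MeasurableSet {ω | X s ω < τ} := fun s => measurableSet_lt (hX s) measurable_const
  have hone : ∀ s, P.real {ω | X s ω < τ} = Real.exp (-(τ⁻¹ * 1)) := fun s => by
    have := h.measureReal_pair_lt s s hτ
    simpa [h.lintegral_eq_one] using this
  have hpair := h.measureReal_pair_lt 0 t hτ
  have hc0 : {ω | τ ≤ X 0 ω} = {ω | X 0 ω < τ}ᶜ := by ext; simp
  have hcap : {ω | τ ≤ X 0 ω} ∩ {ω | τ ≤ X t ω} = ({ω | X 0 ω < τ} ∪ {ω | X t ω < τ})ᶜ := by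
    ext; simp
  have hcup := measureReal_union_add_inter (μ := P) (s := {ω | X 0 ω < τ}) (hlt t)
  have hinter : {ω | X 0 ω < τ} ∩ {ω | X t ω < τ} = {ω | X 0 ω < τ ∧ X t ω < τ} := rfl
  rw [hinter, hpair, hone, hone, ← hθ] at hcup
  have hcond : (ProbabilityTheory.cond P {ω | τ ≤ X 0 ω}).real {ω | τ ≤ X t ω} =
      (P.real {ω | τ ≤ X 0 ω})⁻¹ * P.real ({ω | τ ≤ X 0 ω} ∩ {ω | τ ≤ X t ω}) := by
    simp [measureReal_def, cond_apply hm0]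
  rw [hcond, hcap, hc0, probReal_compl_eq_one_sub (hlt 0),
    probReal_compl_eq_one_sub ((hlt 0).union (hlt t)), hone, eq_sub_of_add_eq hcup]
  have hpos : 1 - Real.exp (-(τ⁻¹ * 1)) ≠ 0 := by
    have : Real.exp (-(τ⁻¹ * 1)) < 1 := by simpa using hτ
    linarith
  simp only [Function.comp_apply]
  generalize Real.exp (-(τ⁻¹ * 1)) = a at hpos
  field_simp
  ring

theorem eq_of_hasTCF [IsProbabilityMeasure P]
    (h : HasSpectralRepresentation P X ν V) (hX : ∀ t, Measurable (X t))
    {χ : Space d → ℝ} (hχ : HasTCF P X χ) (t : Space d) :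
    χ t = (∫⁻ ω, min (V 0 ω) (V t ω) ∂ν).toReal :=
  tendsto_nhds_unique (hχ t) (h.hasTCF hX t)

end HasSpectralRepresentation

/-! ### Void probabilities of a Poisson process -/

section Poisson

variable {S : Type} [MeasurableSpace S]

/-- The unit-mass measure `Lebesgue × μ` on the strip `(j, j + 1] × S`. -/
noncomputable def stripMeasure (μ : Measure S) (j : ℕ) : Measure (ℝ × S) :=
  ((volume : Measure ℝ).restrict (Set.Ioc (j : ℝ) (j + 1))).prod μ

instance (μ : Measure S) [IsProbabilityMeasure μ] (j : ℕ) :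
    IsProbabilityMeasure (stripMeasure μ j) := by
  have : IsProbabilityMeasure ((volume : Measure ℝ).restrict (Set.Ioc (j : ℝ) (j + 1))) :=
    ⟨by simp⟩
  unfold stripMeasure
  infer_instance

/-- The law of a Poisson number of independent points with distribution `κ`. -/
noncomputable def poissonPoints {E : Type} [MeasurableSpace E] (κ : Measure E)
    [IsProbabilityMeasure κ] : Measure (ℕ × (ℕ → E)) :=
  (poissonMeasure 1).prod (Measure.infinitePi fun _ => κ)

instance {E : Type} [MeasurableSpace E] (κ : Measure E) [IsProbabilityMeasure κ] :
    IsProbabilityMeasure (poissonPoints κ) := by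
  unfold poissonPoints
  infer_instance

theorem measurableSet_forall_lt_mem {E : Type} [MeasurableSpace E] {B : Set E}
    (hB : MeasurableSet B) : MeasurableSet {p : ℕ × (ℕ → E) | ∀ i < p.1, p.2 i ∈ B} := by
  have : {p : ℕ × (ℕ → E) | ∀ i < p.1, p.2 i ∈ B} =
      ⋂ i : ℕ, ({p | p.1 ≤ i} ∪ {p | p.2 i ∈ B}) := by
    ext p
    simp only [Set.mem_ofPred_eq, Set.mem_iInter, Set.mem_union]
    exact forall_congr' fun i => by rw [← not_lt]; tauto
  rw [this]
  refine MeasurableSet.iInter fun i => MeasurableSet.union ?_ ?_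
  · exact measurableSet_le measurable_fst measurable_const
  · exact ((measurable_pi_apply i).comp measurable_snd) hB

/-- Conditionally on `n` points the probability is `κ(B)^n`; averaging over the Poisson law sums the
exponential series to `e^(κ(B) - 1)`. These void probabilities are all that is needed of the Poisson
process. -/
theorem poissonPoints_forall_mem {E : Type} [MeasurableSpace E] (κ : Measure E)
    [IsProbabilityMeasure κ] {B : Set E} (hB : MeasurableSet B) :
    poissonPoints κ {p | ∀ i < p.1, p.2 i ∈ B} = ENNReal.ofReal (Real.exp (-κ.real Bᶜ)) := by
  rw [poissonPoints, Measure.prod_apply (measurableSet_forall_lt_mem hB)]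
  have hsec : ∀ n : ℕ, Measure.infinitePi (fun _ : ℕ => κ)
      (Prod.mk n ⁻¹' {p : ℕ × (ℕ → E) | ∀ i < p.1, p.2 i ∈ B}) = ENNReal.ofReal (κ.real B ^ n) := by
    intro n
    have : Prod.mk n ⁻¹' {p : ℕ × (ℕ → E) | ∀ i < p.1, p.2 i ∈ B} =
        Set.pi (Finset.range n : Set ℕ) fun _ => B := by
      ext z
      simp
    rw [this, Measure.infinitePi_pi _ fun _ _ => hB, Finset.prod_const, Finset.card_range,
      ENNReal.ofReal_pow measureReal_nonneg, ofReal_measureReal]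
  simp only [hsec]
  rw [lintegral_countable', probReal_compl_eq_one_sub hB]
  have hterm : ∀ n : ℕ, ENNReal.ofReal (κ.real B ^ n) * poissonMeasure 1 {n} =
      ENNReal.ofReal (Real.exp (-1) * (κ.real B ^ n / n.factorial)) := by
    intro n
    rw [poissonMeasure_singleton, ← ENNReal.ofReal_mul (pow_nonneg measureReal_nonneg n)]
    congr 1
    simp only [NNReal.coe_one, one_pow]
    ring
  simp only [hterm]
  have hs : HasSum (fun n : ℕ => Real.exp (-1) * (κ.real B ^ n / n.factorial))
      (Real.exp (-1) * Real.exp (κ.real B)) := by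
    refine HasSum.mul_left _ ?_
    rw [Real.exp_eq_exp_ℝ]
    exact NormedSpace.expSeries_div_hasSum_exp _
  rw [← ENNReal.ofReal_tsum_of_nonneg (fun n => by positivity) hs.summable, hs.tsum_eq,
    ← Real.exp_add]
  congr 2
  ring

theorem tprod_ofReal_exp_neg {a : ℕ → ℝ} {A : ℝ} (h : HasSum a A) :
    ∏' j, ENNReal.ofReal (Real.exp (-a j)) = ENNReal.ofReal (Real.exp (-A)) := by
  refine HasProd.tprod_eq ?_
  have h1 : HasProd (fun j => Real.exp (-a j)) (Real.exp (-A)) := h.neg.rexp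
  have h2 := ENNReal.tendsto_ofReal h1
  refine Tendsto.congr (fun s => ?_) h2
  exact ENNReal.ofReal_prod_of_nonneg fun j _ => (Real.exp_pos _).le

/-- The strips tile the half-line. They are used because each has mass one, so its points can be
drawn as a Poisson(1) number of independent samples from a probability measure. -/
theorem hasSum_stripMeasure (μ : Measure S) [IsProbabilityMeasure μ] {B : Set (ℝ × S)}
    (hB : MeasurableSet B)
    (hfin : (((volume : Measure ℝ).restrict (Set.Ioi 0)).prod μ) B ≠ ∞) :
    HasSum (fun j => (stripMeasure μ j).real B)
      ((((volume : Measure ℝ).restrict (Set.Ioi 0)).prod μ).real B) := by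
  have hunion : (⋃ j : ℕ, Set.Ioc (j : ℝ) (j + 1)) = Set.Ioi 0 := by
    ext x
    simp only [Set.mem_iUnion, Set.mem_Ioc, Set.mem_Ioi]
    constructor
    · rintro ⟨j, hj, -⟩
      exact lt_of_le_of_lt (Nat.cast_nonneg j) hj
    · intro hx
      have hc : 0 < ⌈x⌉₊ := Nat.ceil_pos.2 hx
      refine ⟨⌈x⌉₊ - 1, ?_, ?_⟩
      · exact Nat.lt_ceil.1 (by omega)
      · have : ((⌈x⌉₊ - 1 : ℕ) : ℝ) + 1 = ⌈x⌉₊ := by exact_mod_cast Nat.sub_add_cancel hc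
        rw [this]
        exact Nat.le_ceil x
  have hdisj : Pairwise (Function.onFun Disjoint fun j : ℕ => Set.Ioc (j : ℝ) (j + 1)) := by
    intro i j hij
    rw [Function.onFun, Set.disjoint_left]
    rintro x ⟨h1, h2⟩ ⟨h3, h4⟩
    have h5 : (i : ℝ) < j + 1 := h1.trans_le h4
    have h6 : (j : ℝ) < i + 1 := h3.trans_le h2
    norm_cast at h5 h6
    omega
  have hsum : (((volume : Measure ℝ).restrict (Set.Ioi 0)).prod μ) B =
      ∑' j, stripMeasure μ j B := by
    rw [← hunion, Measure.restrict_iUnion hdisj fun _ => measurableSet_Ioc, Measure.prod_sum_left,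
      Measure.sum_apply _ hB]
    rfl
  have h1 := (ENNReal.hasSum_toReal (f := fun j => stripMeasure μ j B) (hsum ▸ hfin))
  rw [← ENNReal.tsum_toReal_eq (fun j => measure_ne_top _ _), ← hsum] at h1
  exact h1

end Poisson

/-! ### Existence of processes with a given spectral representation -/

section Existence

variable {d : ℕ} {S : Type}

/-- The maximum over the points `(g, y)` of a family of point clouds of `V y / g`. -/
noncomputable def poissonSup (V : S → ℝ≥0∞) (ω : ℕ → ℕ × (ℕ → ℝ × S)) : ℝ≥0∞ :=
  ⨆ (j : ℕ) (i : ℕ), if i < (ω j).1 then V ((ω j).2 i).2 / ENNReal.ofReal ((ω j).2 i).1 else 0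

theorem poissonSup_le_iff (V : S → ℝ≥0∞) (ω : ℕ → ℕ × (ℕ → ℝ × S)) (b : ℝ≥0∞) :
    poissonSup V ω ≤ b ↔ ∀ j, ∀ i < (ω j).1,
      V ((ω j).2 i).2 / ENNReal.ofReal ((ω j).2 i).1 ≤ b := by
  simp only [poissonSup, iSup_le_iff]
  refine forall_congr' fun j => forall_congr' fun i => ?_
  split_ifs with h <;> simp [h]

variable [MeasurableSpace S]

theorem measurable_poissonSup {V : S → ℝ≥0∞} (hV : Measurable V) :
    Measurable (poissonSup V) := by
  refine Measurable.iSup fun j => Measurable.iSup fun i => ?_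
  have hp : Measurable fun ω : ℕ → ℕ × (ℕ → ℝ × S) => (ω j).2 i :=
    (measurable_pi_apply i).comp (measurable_snd.comp (measurable_pi_apply j))
  refine Measurable.ite ?_ ?_ measurable_const
  · exact measurableSet_lt measurable_const (measurable_fst.comp (measurable_pi_apply j))
  · exact (hV.comp (measurable_snd.comp hp)).div
      (ENNReal.measurable_ofReal.comp (measurable_fst.comp hp))

/-- The law of the point clouds of a Poisson process on `(0,∞) × S` with intensity
`Lebesgue × μ`, strip by strip. -/
noncomputable def cloudMeasure (μ : Measure S) [IsProbabilityMeasure μ] :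
    Measure (ℕ → ℕ × (ℕ → ℝ × S)) :=
  Measure.infinitePi fun j => poissonPoints (stripMeasure μ j)

instance (μ : Measure S) [IsProbabilityMeasure μ] : IsProbabilityMeasure (cloudMeasure μ) := by
  unfold cloudMeasure
  infer_instance

theorem volume_pos_ofReal_lt (a : ℝ≥0∞) :
    volume {y : ℝ | 0 < y ∧ ENNReal.ofReal y < a} = a := by
  by_cases ha : a = ∞
  · rw [ha]
    simp only [ENNReal.ofReal_lt_top, and_true]
    exact Real.volume_Ioi
  · have : {y : ℝ | 0 < y ∧ ENNReal.ofReal y < a} = Set.Ioo 0 a.toReal := by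
      ext y
      simp only [Set.mem_ofPred_eq, Set.mem_Ioo]
      exact and_congr_right fun hy => ENNReal.ofReal_lt_iff_lt_toReal hy.le ha
    rw [this, Real.volume_Ioo, sub_zero, ENNReal.ofReal_toReal ha]

/-- The substitution `g = 1/u` turns the intensity `u⁻² du` into Lebesgue measure. For fixed `s`
some threshold is exceeded exactly when `g` is below the supremum of `V k s / x k`, a set of levels
whose length is that supremum. -/
theorem prod_measure_lt_div (μ : Measure S) [IsProbabilityMeasure μ] {m : ℕ}
    {V : Fin m → S → ℝ≥0∞} (hV : ∀ k, Measurable (V k)) {x : Fin m → ℝ} (hx : ∀ k, 0 < x k) :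
    (((volume : Measure ℝ).restrict (Set.Ioi 0)).prod μ)
        {p | ∀ k, V k p.2 / ENNReal.ofReal p.1 ≤ ENNReal.ofReal (x k)}ᶜ =
      ∫⁻ s, ⨆ k, V k s / ENNReal.ofReal (x k) ∂μ := by
  have hmeas : MeasurableSet {p : ℝ × S | ∀ k, V k p.2 / ENNReal.ofReal p.1 ≤
      ENNReal.ofReal (x k)}ᶜ := by
    refine MeasurableSet.compl ?_
    simp only [Set.ofPred_forall]
    refine MeasurableSet.iInter fun k => measurableSet_le ?_ measurable_const
    exact ((hV k).comp measurable_snd).div (ENNReal.measurable_ofReal.comp measurable_fst)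
  rw [Measure.prod_apply_symm hmeas]
  refine lintegral_congr fun s => ?_
  set M := ⨆ k, V k s / ENNReal.ofReal (x k) with hM
  have hset : (fun g : ℝ => (g, s)) ⁻¹'
      {p | ∀ k, V k p.2 / ENNReal.ofReal p.1 ≤ ENNReal.ofReal (x k)}ᶜ ∩ Set.Ioi 0 =
      {g : ℝ | 0 < g ∧ ENNReal.ofReal g < M} := by
    ext g
    simp only [Set.mem_inter_iff, Set.mem_preimage, Set.mem_compl_iff, Set.mem_ofPred_eq,
      Set.mem_Ioi]
    rw [and_comm]
    refine and_congr_right fun hg => ?_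
    rw [hM, lt_iSup_iff]
    push Not
    refine exists_congr fun k => ?_
    rw [← not_le, ← not_le, ENNReal.div_le_iff (by simp [hg]) ENNReal.ofReal_ne_top,
      ENNReal.div_le_iff (by simp [hx k]) ENNReal.ofReal_ne_top, mul_comm]
  rw [Measure.restrict_apply (measurable_prodMk_right hmeas), hset, volume_pos_ofReal_lt]

theorem lintegral_iSup_div_ne_top (μ : Measure S) {m : ℕ}
    {V : Fin m → S → ℝ≥0∞} (hV : ∀ k, Measurable (V k)) (hone : ∀ k, ∫⁻ s, V k s ∂μ = 1)
    {x : Fin m → ℝ} (hx : ∀ k, 0 < x k) :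
    ∫⁻ s, ⨆ k, V k s / ENNReal.ofReal (x k) ∂μ ≠ ∞ := by
  refine ne_top_of_le_ne_top (b := ∑ k, ∫⁻ s, V k s / ENNReal.ofReal (x k) ∂μ) ?_ ?_
  · refine ENNReal.sum_ne_top.2 fun k _ => ?_
    simp only [div_eq_mul_inv]
    rw [lintegral_mul_const _ (hV k), hone k]
    simp [hx k]
  · rw [← lintegral_finsetSum _ fun k _ => (hV k).div_const _]
    exact lintegral_mono fun s => iSup_le fun k =>
      Finset.single_le_sum (f := fun k => V k s / ENNReal.ofReal (x k)) (fun _ _ => zero_le)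
        (Finset.mem_univ k)

theorem cloudMeasure_poissonSup_le (μ : Measure S) [IsProbabilityMeasure μ] {m : ℕ}
    {V : Fin m → S → ℝ≥0∞} (hV : ∀ k, Measurable (V k)) (hone : ∀ k, ∫⁻ s, V k s ∂μ = 1)
    {x : Fin m → ℝ} (hx : ∀ k, 0 < x k) :
    cloudMeasure μ {ω | ∀ k, poissonSup (V k) ω ≤ ENNReal.ofReal (x k)} =
      ENNReal.ofReal (Real.exp (-(∫⁻ s, ⨆ k, V k s / ENNReal.ofReal (x k) ∂μ).toReal)) := by
  set B : Set (ℝ × S) := {p | ∀ k, V k p.2 / ENNReal.ofReal p.1 ≤ ENNReal.ofReal (x k)} with hBdef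
  have hB : MeasurableSet B := by
    rw [hBdef]
    simp only [Set.ofPred_forall]
    refine MeasurableSet.iInter fun k => measurableSet_le ?_ measurable_const
    exact ((hV k).comp measurable_snd).div (ENNReal.measurable_ofReal.comp measurable_fst)
  have hset : {ω | ∀ k, poissonSup (V k) ω ≤ ENNReal.ofReal (x k)} =
      Set.pi Set.univ fun _ : ℕ => {p : ℕ × (ℕ → ℝ × S) | ∀ i < p.1, p.2 i ∈ B} := by
    ext ω
    simp only [poissonSup_le_iff, Set.mem_ofPred_eq, Set.mem_pi, Set.mem_univ, forall_const, hBdef]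
    constructor
    · exact fun h j i hi k => h k j i hi
    · exact fun h k j i hi => h j i hi k
  have hprod := prod_measure_lt_div μ hV hx
  have hfin := lintegral_iSup_div_ne_top μ hV hone hx
  rw [hset, cloudMeasure, Measure.infinitePi_pi_univ _ fun _ => measurableSet_forall_lt_mem hB]
  simp only [poissonPoints_forall_mem _ hB]
  rw [tprod_ofReal_exp_neg (hasSum_stripMeasure μ hB.compl (by rw [hprod]; exact hfin)),
    measureReal_def, hprod]

/-- The real-valued process is obtained by `toReal`, which sends `∞` to 0, so infinite suprema must
be shown negligible: the Fréchet tail `1 - e^(-1/x)` tends to 0. -/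
theorem cloudMeasure_poissonSup_eq_top (μ : Measure S) [IsProbabilityMeasure μ]
    {V : S → ℝ≥0∞} (hV : Measurable V) (hone : ∫⁻ s, V s ∂μ = 1) :
    cloudMeasure μ {ω | poissonSup V ω = ∞} = 0 := by
  have hle : ∀ x : ℝ, 0 < x → cloudMeasure μ {ω | poissonSup V ω ≤ ENNReal.ofReal x} =
      ENNReal.ofReal (Real.exp (-x⁻¹)) := by
    intro x hx
    have := cloudMeasure_poissonSup_le μ (m := 1) (V := fun _ => V) (fun _ => hV) (fun _ => hone)
      (x := fun _ => x) (fun _ => hx)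
    simp only [forall_const, ciSup_const, div_eq_mul_inv] at this
    rw [this, lintegral_mul_const _ hV, hone, one_mul, ENNReal.toReal_inv,
      ENNReal.toReal_ofReal hx.le]
  have hlim : Tendsto (fun x : ℝ => 1 - ENNReal.ofReal (Real.exp (-x⁻¹))) atTop (𝓝 0) := by
    have h1 : Tendsto (fun x : ℝ => ENNReal.ofReal (Real.exp (-x⁻¹))) atTop (𝓝 1) := by
      have h0 : Tendsto (fun x : ℝ => Real.exp (-x⁻¹)) atTop (𝓝 1) := by
        simpa [Function.comp_def] using
          (Real.continuous_exp.tendsto _).comp (tendsto_inv_atTop_zero (𝕜 := ℝ)).neg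
      simpa using ENNReal.tendsto_ofReal h0
    simpa using ENNReal.Tendsto.sub tendsto_const_nhds h1 (Or.inl ENNReal.one_ne_top)
  refine le_antisymm (ge_of_tendsto hlim ?_) zero_le
  filter_upwards [eventually_gt_atTop 0] with x hx
  rw [← hle x hx, ← prob_compl_eq_one_sub
    (measurableSet_le (measurable_poissonSup hV) measurable_const)]
  refine measure_mono fun ω hω => ?_
  simp only [Set.mem_ofPred_eq] at hω
  simp [hω]

theorem exists_process_of_probability (μ : Measure S) [IsProbabilityMeasure μ]
    {V : Space d → S → ℝ≥0∞} (hV : ∀ t, Measurable (V t)) (hone : ∀ t, ∫⁻ s, V t s ∂μ = 1) :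
    (∀ t, Measurable fun ω => (poissonSup (V t) ω).toReal) ∧
      HasSpectralRepresentation (cloudMeasure μ) (fun t ω => (poissonSup (V t) ω).toReal) μ V := by
  refine ⟨fun t => (measurable_poissonSup (hV t)).ennreal_toReal, hV, hone, fun m t x hx => ?_⟩
  have hae : {ω | ∀ k, (poissonSup (V (t k)) ω).toReal ≤ x k} =ᵐ[cloudMeasure μ]
      {ω | ∀ k, poissonSup (V (t k)) ω ≤ ENNReal.ofReal (x k)} := by
    have hfin : ∀ᵐ ω ∂cloudMeasure μ, ∀ k, poissonSup (V (t k)) ω ≠ ∞ := by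
      refine ae_all_iff.2 fun k => ?_
      rw [ae_iff]
      simpa using cloudMeasure_poissonSup_eq_top μ (hV (t k)) (hone (t k))
    filter_upwards [hfin] with ω hω
    refine propext (forall_congr' fun k => ?_)
    exact (ENNReal.le_ofReal_iff_toReal_le (hω k) (hx k).le).symm
  rw [measureReal_congr hae, measureReal_def,
    cloudMeasure_poissonSup_le μ (fun k => hV (t k)) (fun k => hone (t k)) hx,
    ENNReal.toReal_ofReal (Real.exp_pos _).le]

/-- A σ-finite `ν` is replaced by an equivalent probability measure, and the density is absorbed
into the spectral functions. This leaves all the integrals in the representation unchanged. -/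
theorem exists_process (ν : Measure S) [SigmaFinite ν]
    {V : Space d → S → ℝ≥0∞} (hV : ∀ t, Measurable (V t)) (hone : ∀ t, ∫⁻ s, V t s ∂ν = 1) :
    ∃ (Ω : Type) (_ : MeasurableSpace Ω) (P : Measure Ω) (_ : IsProbabilityMeasure P)
      (X : Space d → Ω → ℝ), (∀ t, Measurable (X t)) ∧ HasSpectralRepresentation P X ν V := by
  have : NeZero ν := ⟨fun h => by simpa [h] using hone 0⟩
  set μ := ν.toFinite
  have hac : ν ≪ μ := absolutelyContinuous_toFinite ν
  have hρ := Measure.measurable_rnDeriv ν μ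
  have hW : ∀ t, Measurable fun s => ν.rnDeriv μ s * V t s := fun t => hρ.mul (hV t)
  have hWone : ∀ t, ∫⁻ s, ν.rnDeriv μ s * V t s ∂μ = 1 := fun t => by
    rw [lintegral_rnDeriv_mul hac (hV t).aemeasurable, hone t]
  obtain ⟨hX, h⟩ := exists_process_of_probability μ hW hWone
  refine ⟨_, _, cloudMeasure μ, inferInstance, _, hX, hV, hone, fun m t x hx => ?_⟩
  rw [h.fdd m t x hx]
  have hmeas : Measurable fun s => ⨆ k, V (t k) s / ENNReal.ofReal (x k) :=
    Measurable.iSup fun k => (hV (t k)).div_const _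
  rw [← lintegral_rnDeriv_mul hac hmeas.aemeasurable]
  congr 3
  refine lintegral_congr fun s => ?_
  rw [ENNReal.mul_iSup]
  exact iSup_congr fun k => mul_div_assoc _ _ _

end Existence

/-! ### Slicing the unit ball by hyperplanes -/

section Slicing

/-- The splitting of `ℝ^(n+1)` into the first coordinate and the remaining ones. -/
def splitFirst (n : ℕ) (x : Space (n + 1)) : ℝ × Space n :=
  (x 0, WithLp.toLp 2 fun i => x i.succ)

theorem measurePreserving_splitFirst (n : ℕ) : MeasurePreserving (splitFirst n) := by
  have h1 : MeasurePreserving (@WithLp.ofLp 2 (Fin (n + 1) → ℝ)) :=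
    PiLp.volume_preserving_ofLp (Fin (n + 1))
  have h2 := volume_preserving_piFinSuccAbove (fun _ : Fin (n + 1) => ℝ) 0
  have h3 : MeasurePreserving (Prod.map id (@WithLp.toLp 2 (Fin n → ℝ)))
      (volume : Measure (ℝ × (Fin n → ℝ))) (volume : Measure (ℝ × Space n)) :=
    (MeasurePreserving.id volume).prod (PiLp.volume_preserving_toLp (Fin n))
  exact h3.comp (h2.comp h1)

theorem norm_sq_eq_splitFirst (n : ℕ) (x : Space (n + 1)) :
    ‖x‖ ^ 2 = (splitFirst n x).1 ^ 2 + ‖(splitFirst n x).2‖ ^ 2 := by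
  simp [EuclideanSpace.norm_sq_eq, splitFirst, Fin.sum_univ_succ]

/-- The density of the first coordinate with respect to the volume of the unit ball. -/
noncomputable def sliceDensity (n : ℕ) (v : ℝ) : ℝ≥0∞ :=
  ENNReal.ofReal (√(1 - v ^ 2) ^ n) * volume (Metric.closedBall (0 : Space n) 1)

theorem measurable_sliceDensity (n : ℕ) : Measurable (sliceDensity n) := by
  unfold sliceDensity
  fun_prop

/-- Fubini in the first coordinate: the slice of the unit ball at height `v` is a ball of radius
`√(1 - v²)` in one dimension less. -/
theorem volume_closedBall_inter_first (n : ℕ) {A : Set ℝ} (hA : MeasurableSet A) :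
    volume (Metric.closedBall (0 : Space (n + 1)) 1 ∩ {x | x 0 ∈ A}) =
      ∫⁻ v in A ∩ Set.Icc (-1) 1, sliceDensity n v := by
  set T : Set (ℝ × Space n) := {p | p.1 ^ 2 + ‖p.2‖ ^ 2 ≤ 1 ∧ p.1 ∈ A} with hT
  have hTm : MeasurableSet T :=
    MeasurableSet.inter (s₁ := {p : ℝ × Space n | p.1 ^ 2 + ‖p.2‖ ^ 2 ≤ 1})
      (measurableSet_le (by fun_prop) measurable_const) (measurable_fst hA)
  have hpre : Metric.closedBall (0 : Space (n + 1)) 1 ∩ {x | x 0 ∈ A} = splitFirst n ⁻¹' T := by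
    ext x
    simp only [Set.mem_inter_iff, mem_closedBall_zero_iff, Set.mem_ofPred_eq, Set.mem_preimage,
      hT, ← norm_sq_eq_splitFirst]
    rw [sq_le_one_iff₀ (norm_nonneg x)]
    rfl
  rw [hpre, (measurePreserving_splitFirst n).measure_preimage hTm.nullMeasurableSet,
    Measure.volume_eq_prod, Measure.prod_apply hTm,
    ← lintegral_indicator (hA.inter measurableSet_Icc)]
  refine lintegral_congr fun v => ?_
  by_cases hv : v ∈ A ∩ Set.Icc (-1) 1
  · rw [Set.indicator_of_mem hv]
    have hv1 : v ^ 2 ≤ 1 := by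
      have := hv.2.1
      have := hv.2.2
      nlinarith
    have : Prod.mk v ⁻¹' T = Metric.closedBall (0 : Space n) √(1 - v ^ 2) := by
      ext w
      simp only [hT, Set.mem_preimage, Set.mem_ofPred_eq, hv.1, and_true, mem_closedBall_zero_iff]
      rw [Real.le_sqrt (norm_nonneg w) (by linarith)]
      constructor <;> intro h <;> linarith
    rw [this, Measure.addHaar_closedBall' _ _ (Real.sqrt_nonneg _), finrank_euclideanSpace_fin,
      sliceDensity]
  · rw [Set.indicator_of_notMem hv]
    have : Prod.mk v ⁻¹' T = ∅ := by
      ext w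
      simp only [hT, Set.mem_preimage, Set.mem_ofPred_eq, Set.mem_empty_iff_false, iff_false]
      rintro ⟨h1, h2⟩
      refine hv ⟨h2, ?_⟩
      have : v ^ 2 ≤ 1 := by nlinarith [sq_nonneg ‖w‖]
      exact abs_le.1 (sq_le_one_iff_abs_le_one v |>.1 this)
    rw [this, measure_empty]

/-- Two vectors of the same norm are related by a linear isometry. -/
theorem exists_linearIsometryEquiv_of_norm_eq {d : ℕ} {x y : Space d} (h : ‖x‖ = ‖y‖) :
    ∃ R : Space d ≃ₗᵢ[ℝ] Space d, R x = y :=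
  ⟨_, Submodule.reflection_sub h⟩

theorem map_inner_volume_closedBall (n : ℕ) {e : Space (n + 1)} (he : ‖e‖ = 1) :
    (volume.restrict (Metric.closedBall (0 : Space (n + 1)) 1)).map (fun x => inner ℝ e x) =
      (volume.restrict (Set.Icc (-1) 1)).withDensity (sliceDensity n) := by
  ext A hA
  have hin : Measurable fun x : Space (n + 1) => inner ℝ e x := by fun_prop
  obtain ⟨R, hR⟩ := exists_linearIsometryEquiv_of_norm_eq
    (x := e) (y := EuclideanSpace.single (0 : Fin (n + 1)) (1 : ℝ)) (by simp [he])
  have hm : MeasurableSet (Metric.closedBall (0 : Space (n + 1)) 1 ∩ {x | x 0 ∈ A}) :=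
    measurableSet_closedBall.inter ((by fun_prop : Measurable fun x : Space (n + 1) => x 0) hA)
  rw [Measure.map_apply hin hA, Measure.restrict_apply (hin hA), withDensity_apply _ hA,
    Measure.restrict_restrict hA, ← volume_closedBall_inter_first n hA,
    ← R.measurePreserving.measure_preimage hm.nullMeasurableSet]
  congr 1
  ext x
  have : (R x) 0 = inner ℝ e x := by
    rw [← R.inner_map_map, hR, EuclideanSpace.inner_single_left]
    simp
  simp [this, and_comm]

theorem volume_closedBall_inter_inner (n : ℕ) {e : Space (n + 1)} (he : ‖e‖ = 1) {A : Set ℝ}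
    (hA : MeasurableSet A) :
    volume (Metric.closedBall (0 : Space (n + 1)) 1 ∩ {x | inner ℝ e x ∈ A}) =
      ∫⁻ v in A ∩ Set.Icc (-1) 1, sliceDensity n v := by
  have hin : Measurable fun x : Space (n + 1) => inner ℝ e x := by fun_prop
  rw [← Measure.restrict_restrict hA, ← withDensity_apply _ hA, ← map_inner_volume_closedBall n he,
    Measure.map_apply hin hA, Measure.restrict_apply (hin hA), Set.inter_comm]
  rfl

/-! ### The volume of the intersection of two balls -/

/-- The hyperplane midway between the centres cuts the intersection into two caps, exchanged by `x ↦
r • e - x`. The cap beyond the hyperplane is determined by the first ball alone, hence the factor 2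
and the lower limit `r / 2`. -/
theorem volume_closedBall_inter_closedBall_smul (n : ℕ) {e : Space (n + 1)} (he : ‖e‖ = 1) {r : ℝ}
    (hr : 0 ≤ r) :
    volume (Metric.closedBall (0 : Space (n + 1)) 1 ∩ Metric.closedBall (r • e) 1) =
      2 * ∫⁻ v in Set.Ioc (r / 2) 1, sliceDensity n v := by
  set B := Metric.closedBall (0 : Space (n + 1)) 1 with hB
  set L := B ∩ Metric.closedBall (r • e) 1 with hL
  have hin : Measurable fun x : Space (n + 1) => inner ℝ e x := by fun_prop
  have hee : inner ℝ e e = (1 : ℝ) := by rw [real_inner_self_eq_norm_sq, he, one_pow]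
  have hexp : ∀ x, ‖x - r • e‖ ^ 2 = ‖x‖ ^ 2 - 2 * r * inner ℝ e x + r ^ 2 := by
    intro x
    rw [norm_sub_sq_real, inner_smul_right, norm_smul, he, real_inner_comm, mul_one,
      Real.norm_eq_abs, sq_abs]
    ring
  have hm : MeasurableSet {x : Space (n + 1) | inner ℝ e x ∈ Set.Ici (r / 2)} :=
    hin measurableSet_Ici
  have hsplit := measure_inter_add_sdiff (μ := volume) L hm
  have h1 : L ∩ {x | inner ℝ e x ∈ Set.Ici (r / 2)} =
      B ∩ {x | inner ℝ e x ∈ Set.Ici (r / 2)} := by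
    ext x
    simp only [hL, hB, Set.mem_inter_iff, mem_closedBall_iff_norm, sub_zero,
      Set.mem_ofPred_eq, Set.mem_Ici]
    constructor
    · exact fun h => ⟨h.1.1, h.2⟩
    · rintro ⟨h1, h2⟩
      refine ⟨⟨h1, ?_⟩, h2⟩
      rw [← sq_le_one_iff₀ (norm_nonneg _)] at h1 ⊢
      rw [hexp]
      nlinarith [mul_le_mul_of_nonneg_left h2 hr]
  have hrefl : MeasurePreserving fun x : Space (n + 1) => r • e - x :=
    Measure.measurePreserving_sub_left volume (r • e)
  have h2 : L \ {x | inner ℝ e x ∈ Set.Ici (r / 2)} =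
      (fun x => r • e - x) ⁻¹' (B ∩ {x | inner ℝ e x ∈ Set.Ioi (r / 2)}) := by
    ext x
    simp only [hL, hB, Set.mem_inter_iff, mem_closedBall_iff_norm, sub_zero,
      Set.mem_ofPred_eq, Set.mem_Ici, Set.mem_sdiff, not_le, Set.mem_preimage, Set.mem_Ioi,
      inner_sub_right, inner_smul_right, hee, norm_sub_rev (r • e) x]
    constructor
    · rintro ⟨⟨h1, h2⟩, h3⟩
      exact ⟨h2, by linarith⟩
    · rintro ⟨h1, h2⟩
      refine ⟨⟨?_, h1⟩, by linarith⟩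
      rw [← sq_le_one_iff₀ (norm_nonneg _)] at h1 ⊢
      rw [hexp] at h1
      nlinarith [mul_le_mul_of_nonneg_left h2.le hr]
  have hm' : MeasurableSet (B ∩ {x : Space (n + 1) | inner ℝ e x ∈ Set.Ioi (r / 2)}) :=
    measurableSet_closedBall.inter (hin measurableSet_Ioi)
  have hr' : -1 < r / 2 := by linarith
  have h3 : Set.Ici (r / 2) ∩ Set.Icc (-1) 1 = Set.Icc (r / 2) 1 := by
    ext v
    simp only [Set.mem_inter_iff, Set.mem_Ici, Set.mem_Icc]
    exact ⟨fun h => ⟨h.1, h.2.2⟩, fun h => ⟨h.1, by linarith [h.1], h.2⟩⟩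
  have h4 : Set.Ioi (r / 2) ∩ Set.Icc (-1) 1 = Set.Ioc (r / 2) 1 := by
    ext v
    simp only [Set.mem_inter_iff, Set.mem_Ioi, Set.mem_Icc, Set.mem_Ioc]
    exact ⟨fun h => ⟨h.1, h.2.2⟩, fun h => ⟨h.1, by linarith [h.1], h.2⟩⟩
  rw [← hsplit, h1, h2, hrefl.measure_preimage hm'.nullMeasurableSet,
    volume_closedBall_inter_inner n he measurableSet_Ici,
    volume_closedBall_inter_inner n he measurableSet_Ioi, h3, h4,
    ← restrict_Ioc_eq_restrict_Icc, two_mul]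

theorem volume_closedBall_one (n : ℕ) : volume (Metric.closedBall (0 : Space n) 1) =
    ENNReal.ofReal (√Real.pi ^ n / Real.Gamma (n / 2 + 1)) := by
  -- Dimension zero is needed: its ball, a single point of mass one, is the slice of the
  -- one-dimensional ball.
  rcases Nat.eq_zero_or_pos n with rfl | hn
  · have : Metric.closedBall (0 : Space 0) 1 = Set.univ :=
      Set.eq_univ_of_forall fun x => by simp [Subsingleton.elim x 0]
    rw [this, volume_euclideanSpace_eq_dirac]
    simp
  · have : Nonempty (Fin n) := ⟨⟨0, hn⟩⟩
    rw [EuclideanSpace.volume_closedBall]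
    simp

/-- The Gamma factors in `hFun` are twice the ratio of the unit ball volumes in dimensions `n` and
`n + 1`. Thus `hFun` is the normalised overlap of two balls. -/
theorem lintegral_sliceDensity (n : ℕ) {t : ℝ} (ht : 0 ≤ t) :
    2 * ∫⁻ v in Set.Ioc t 1, sliceDensity n v =
      volume (Metric.closedBall (0 : Space (n + 1)) 1) * ENNReal.ofReal (hFun (n + 1) t) := by
  unfold sliceDensity
  rw [lintegral_mul_const _ (by fun_prop)]
  have hint : IntegrableOn (fun v : ℝ => √(1 - v ^ 2) ^ n) (Set.Ioc t 1) :=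
    (by fun_prop : Continuous fun v : ℝ => √(1 - v ^ 2) ^ n).integrableOn_Ioc
  rw [← ofReal_integral_eq_lintegral_ofReal hint (ae_of_all _ fun v => by positivity)]
  have hpow : ∫ v in Set.Ioc t 1, (1 - v ^ 2) ^ ((((n + 1 : ℕ) : ℝ) - 1) / 2) =
      ∫ v in Set.Ioc t 1, √(1 - v ^ 2) ^ n := by
    refine setIntegral_congr_fun measurableSet_Ioc fun v hv => ?_
    have : 0 ≤ 1 - v ^ 2 := by nlinarith [hv.1, hv.2]
    rw [Real.sqrt_eq_rpow, ← Real.rpow_natCast _ n, ← Real.rpow_mul this]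
    congr 1
    push_cast
    ring
  rw [hFun, hpow, volume_closedBall_one, volume_closedBall_one]
  have hI : 0 ≤ ∫ v in Set.Ioc t 1, √(1 - v ^ 2) ^ n := integral_nonneg fun v => by positivity
  generalize (∫ v in Set.Ioc t 1, √(1 - v ^ 2) ^ n) = I at hI ⊢
  have hG1 : 0 < Real.Gamma ((n : ℝ) / 2 + 1) := Real.Gamma_pos_of_pos (by positivity)
  have hG2 : 0 < Real.Gamma (((n + 1 : ℕ) : ℝ) / 2) := Real.Gamma_pos_of_pos (by positivity)
  have hGs : Real.Gamma (((n + 1 : ℕ) : ℝ) / 2 + 1) =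
      ((n + 1 : ℕ) : ℝ) / 2 * Real.Gamma (((n + 1 : ℕ) : ℝ) / 2) :=
    Real.Gamma_add_one (by positivity)
  have hGe : (((n + 1 : ℕ) : ℝ) + 1) / 2 = (n : ℝ) / 2 + 1 := by push_cast; ring
  have hpi : 0 < √Real.pi := Real.sqrt_pos.2 Real.pi_pos
  rw [hGs, hGe, ← ENNReal.ofReal_mul (by positivity), ← ENNReal.ofReal_mul (by positivity),
    ← ENNReal.ofReal_ofNat, ← ENNReal.ofReal_mul (by positivity)]
  congr 1
  generalize Real.Gamma (((n + 1 : ℕ) : ℝ) / 2) = g2 at *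
  generalize Real.Gamma ((n : ℝ) / 2 + 1) = g1 at *
  have : ((n + 1 : ℕ) : ℝ) ≠ 0 := by positivity
  field_simp
  ring

theorem exists_norm_one_smul (n : ℕ) (x : Space (n + 1)) :
    ∃ e : Space (n + 1), ‖e‖ = 1 ∧ x = ‖x‖ • e := by
  by_cases hx : x = 0
  · exact ⟨EuclideanSpace.single 0 1, by simp, by simp [hx]⟩
  · refine ⟨‖x‖⁻¹ • x, ?_, ?_⟩
    · rw [norm_smul, norm_inv, norm_norm, inv_mul_cancel₀ (norm_ne_zero_iff.2 hx)]
    · rw [smul_inv_smul₀ (norm_ne_zero_iff.2 hx)]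

theorem volume_unit_closedBall_inter (n : ℕ) (x : Space (n + 1)) :
    volume (Metric.closedBall (0 : Space (n + 1)) 1 ∩ Metric.closedBall x 1) =
      volume (Metric.closedBall (0 : Space (n + 1)) 1) *
        ENNReal.ofReal (hFun (n + 1) (‖x‖ / 2)) := by
  obtain ⟨e, he, hx⟩ := exists_norm_one_smul n x
  conv_lhs => rw [hx]
  rw [volume_closedBall_inter_closedBall_smul n he (norm_nonneg x),
    lintegral_sliceDensity n (by positivity)]

/-- The volume of the intersection of two balls of the same radius. -/
theorem volume_closedBall_inter_closedBall (n : ℕ) (x : Space (n + 1)) {R : ℝ} (hR : 0 < R) :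
    volume (Metric.closedBall (0 : Space (n + 1)) R ∩ Metric.closedBall x R) =
      volume (Metric.closedBall (0 : Space (n + 1)) R) *
        ENNReal.ofReal (hFun (n + 1) (‖x‖ / (2 * R))) := by
  have hball : ∀ y : Space (n + 1), Metric.closedBall (R • y) R = R • Metric.closedBall y 1 := by
    intro y
    rw [smul_closedBall' hR.ne']
    simp [abs_of_pos hR]
  have h0 := hball 0
  have h1 := hball (R⁻¹ • x)
  rw [smul_zero] at h0
  rw [smul_inv_smul₀ hR.ne'] at h1
  rw [h1, h0, ← Set.smul_set_inter₀ hR.ne', Measure.addHaar_smul, Measure.addHaar_smul,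
    volume_unit_closedBall_inter, mul_assoc, norm_smul, norm_inv, Real.norm_of_nonneg hR.le]
  congr 4
  field_simp

/-- Two coinciding balls overlap completely, so no evaluation of the integral is required. -/
theorem hFun_zero (n : ℕ) : hFun (n + 1) 0 = 1 := by
  have h := volume_unit_closedBall_inter n 0
  rw [Set.inter_self, norm_zero, zero_div] at h
  have h0 : volume (Metric.closedBall (0 : Space (n + 1)) 1) ≠ 0 :=
    (Metric.measure_closedBall_pos _ _ one_pos).ne'
  have ht : volume (Metric.closedBall (0 : Space (n + 1)) 1) ≠ ∞ := measure_closedBall_lt_top.ne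
  have h1 : ENNReal.ofReal (hFun (n + 1) 0) = 1 := by
    rw [← ENNReal.mul_right_inj h0 ht, ← h, mul_one]
  simpa using h1

end Slicing

/-! ### Polar coordinates and the turning bands operator -/

section Polar

/-- The surface measure of the unit sphere of `ℝ^d`. -/
noncomputable abbrev sphereMeasure (d : ℕ) : Measure (Metric.sphere (0 : Space d) 1) :=
  (volume : Measure (Space d)).toSphere

theorem integral_polar {d : ℕ} (hd : 1 ≤ d) {f : Space d → ℝ} (hf : Integrable f) :
    ∫ x, f x = ∫ u, (∫ r in Set.Ioi (0 : ℝ), r ^ (d - 1) * f (r • (u : Space d)))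
      ∂(sphereMeasure d) := by
  have : Nonempty (Fin d) := ⟨⟨0, hd⟩⟩
  have hmp := (volume : Measure (Space d)).measurePreserving_homeomorphUnitSphereProd
  have hemb := (homeomorphUnitSphereProd (Space d)).measurableEmbedding
  set g : Metric.sphere (0 : Space d) 1 × Set.Ioi (0 : ℝ) → ℝ :=
    fun p => f ((p.2 : ℝ) • (p.1 : Space d)) with hg
  have hgf : ∀ x : ({0}ᶜ : Set (Space d)), g (homeomorphUnitSphereProd (Space d) x) = f x := by
    rintro ⟨x, hx⟩
    have hx' : ‖x‖ ≠ 0 := norm_ne_zero_iff.2 hx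
    simp [hg, smul_inv_smul₀ hx']
  have hint : Integrable g (((volume : Measure (Space d)).toSphere).prod
      (Measure.volumeIoiPow (Module.finrank ℝ (Space d) - 1))) := by
    rw [← hmp.integrable_comp_emb hemb]
    have h1 : Integrable (fun x : ({0}ᶜ : Set (Space d)) => f x)
        (Measure.comap Subtype.val volume) :=
      (integrableOn_iff_comap_subtypeVal (μ := volume) (f := f)
        (measurableSet_singleton (0 : Space d)).compl).1 hf.integrableOn
    exact h1.congr (ae_of_all _ fun x => (hgf x).symm)
  calc
    ∫ x, f x = ∫ x : ({0}ᶜ : Set (Space d)), f x ∂(Measure.comap Subtype.val volume) := by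
      rw [integral_subtype_comap (measurableSet_singleton _).compl f,
        restrict_compl_singleton]
    _ = ∫ x : ({0}ᶜ : Set (Space d)), g (homeomorphUnitSphereProd (Space d) x)
          ∂(Measure.comap Subtype.val volume) := by simp only [hgf]
    _ = ∫ p, g p ∂(((volume : Measure (Space d)).toSphere).prod
          (Measure.volumeIoiPow (Module.finrank ℝ (Space d) - 1))) := hmp.integral_comp hemb g
    _ = ∫ u, (∫ r, g (u, r) ∂(Measure.volumeIoiPow (Module.finrank ℝ (Space d) - 1)))
          ∂(sphereMeasure d) := integral_prod _ hint
    _ = _ := by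
      refine integral_congr_ae (ae_of_all _ fun u => ?_)
      simp only [Measure.volumeIoiPow, ENNReal.ofReal, finrank_euclideanSpace_fin]
      rw [integral_withDensity_eq_integral_smul
        ((measurable_subtype_coe.pow_const _).real_toNNReal),
        integral_subtype_comap measurableSet_Ioi
          fun a : ℝ => Real.toNNReal (a ^ (d - 1)) • f (a • (u : Space d))]
      refine setIntegral_congr_fun measurableSet_Ioi fun r hr => ?_
      simp only [NNReal.smul_def, Real.coe_toNNReal _ (pow_nonneg (le_of_lt hr) _), smul_eq_mul]

theorem integral_closedBall_polar {d : ℕ} (hd : 1 ≤ d) {f : Space d → ℝ}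
    (hf : IntegrableOn f (Metric.closedBall 0 1)) :
    ∫ x in Metric.closedBall 0 1, f x =
      ∫ u, (∫ r in (0 : ℝ)..1, r ^ (d - 1) * f (r • (u : Space d))) ∂(sphereMeasure d) := by
  rw [← integral_indicator measurableSet_closedBall,
    integral_polar hd ((integrable_indicator_iff measurableSet_closedBall).2 hf)]
  refine integral_congr_ae (ae_of_all _ fun u => ?_)
  have hu : ‖(u : Space d)‖ = 1 := mem_sphere_zero_iff_norm.1 u.2
  simp only
  rw [intervalIntegral.integral_of_le zero_le_one, ← integral_indicator measurableSet_Ioi,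
    ← integral_indicator measurableSet_Ioc]
  congr 1
  ext r
  by_cases h0 : 0 < r
  · by_cases h1 : r ≤ 1
    · have : r • (u : Space d) ∈ Metric.closedBall (0 : Space d) 1 := by
        simp [norm_smul, hu, abs_of_pos h0, h1]
      simp [h0, h1, this]
    · have : r • (u : Space d) ∉ Metric.closedBall (0 : Space d) 1 := by
        simpa [norm_smul, hu, abs_of_pos h0] using h1
      simp [h0, h1, this]
  · simp [h0]

/-- The function is extended to be constant along rays, and the radial integral of `r^(d-1)`
contributes `1/d`. Questions about the surface measure thereby become questions about Lebesgue
measure on the ball. -/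
theorem integral_sphere_eq {d : ℕ} (hd : 1 ≤ d) {f : Space d → ℝ} (hf : Measurable f) {C : ℝ}
    (hC : ∀ x, |f x| ≤ C) :
    ∫ u, f u ∂(sphereMeasure d) =
      d * ∫ x in Metric.closedBall (0 : Space d) 1, f (‖x‖⁻¹ • x) := by
  have hm : Measurable fun x : Space d => f (‖x‖⁻¹ • x) := hf.comp (by fun_prop)
  have hint : IntegrableOn (fun x : Space d => f (‖x‖⁻¹ • x)) (Metric.closedBall 0 1) := by
    refine Measure.integrableOn_of_bounded (M := C) measure_closedBall_lt_top.ne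
      hm.aestronglyMeasurable (ae_of_all _ fun x => ?_)
    exact hC _
  rw [integral_closedBall_polar hd hint, ← integral_const_mul]
  refine integral_congr_ae (ae_of_all _ fun u => ?_)
  have hu : ‖(u : Space d)‖ = 1 := mem_sphere_zero_iff_norm.1 u.2
  have : ∫ r in (0 : ℝ)..1, r ^ (d - 1) * f (‖r • (u : Space d)‖⁻¹ • r • (u : Space d)) =
      ∫ r in (0 : ℝ)..1, r ^ (d - 1) * f u := by
    refine intervalIntegral.integral_congr_ae (ae_of_all _ fun r hr => ?_)
    rw [Set.uIoc_of_le zero_le_one] at hr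
    rw [norm_smul, hu, mul_one, Real.norm_of_nonneg hr.1.le, inv_smul_smul₀ hr.1.ne']
  simp only
  rw [this, intervalIntegral.integral_mul_const, integral_pow, Nat.cast_sub hd]
  have hd0 : d ≠ 0 := by omega
  have hd' : (d : ℝ) ≠ 0 := by exact_mod_cast hd0
  simp only [Nat.sub_add_cancel hd, one_pow, zero_pow hd0, Nat.cast_one, sub_zero, sub_add_cancel]
  field_simp

/-! ### The tent function and its spherical averages -/

theorem continuous_tent : Continuous tent := by
  unfold tent
  fun_prop

theorem tent_nonneg (t : ℝ) : 0 ≤ tent t := le_max_right _ _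

theorem tent_le_one (t : ℝ) : tent t ≤ 1 := max_le (by linarith [abs_nonneg t]) zero_le_one

theorem abs_tent_le_one (t : ℝ) : |tent t| ≤ 1 := by
  rw [abs_of_nonneg (tent_nonneg t)]
  exact tent_le_one t

theorem phi_eq {d : ℕ} (x : Space d) : phi d x =
    ((sphereMeasure d).real Set.univ)⁻¹ * ∫ u, tent (inner ℝ (u : Space d) x) ∂(sphereMeasure d) :=
  average_eq _ _

theorem integrable_tent_inner {d : ℕ} (x : Space d) :
    Integrable (fun u : Metric.sphere (0 : Space d) 1 => tent (inner ℝ (u : Space d) x))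
      (sphereMeasure d) := by
  refine Integrable.of_bound (C := 1) ?_ (ae_of_all _ fun u => abs_tent_le_one _)
  exact (continuous_tent.comp (by fun_prop)).aestronglyMeasurable

/-- Rotation invariance of the sphere average is read off from invariance of Lebesgue measure on the
ball under linear isometries. -/
theorem phi_eq_of_norm_eq {d : ℕ} (hd : 1 ≤ d) {x y : Space d} (h : ‖x‖ = ‖y‖) :
    phi d x = phi d y := by
  obtain ⟨R, rfl⟩ := exists_linearIsometryEquiv_of_norm_eq h
  have hmeas : ∀ z : Space d, Measurable fun u : Space d => tent (inner ℝ u z) := fun z =>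
    (continuous_tent.comp (by fun_prop)).measurable
  rw [phi_eq, phi_eq, integral_sphere_eq hd (hmeas x) fun _ => abs_tent_le_one _,
    integral_sphere_eq hd (hmeas (R x)) fun _ => abs_tent_le_one _,
    ← integral_indicator measurableSet_closedBall, ← integral_indicator measurableSet_closedBall,
    ← integral_comp R (Set.indicator _ fun z => tent (inner ℝ (‖z‖⁻¹ • z) (R x)))]
  congr 3
  ext z
  by_cases hz : z ∈ Metric.closedBall (0 : Space d) 1
  · have hRz : R z ∈ Metric.closedBall (0 : Space d) 1 := by simpa using hz
    rw [Set.indicator_of_mem hz, Set.indicator_of_mem hRz, R.norm_map, ← map_smul, R.inner_map_map]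
  · have hRz : R z ∉ Metric.closedBall (0 : Space d) 1 := by simpa using hz
    rw [Set.indicator_of_notMem hz, Set.indicator_of_notMem hRz]

theorem continuous_phi (d : ℕ) : Continuous (phi d) := by
  have : phi d = fun x => ((sphereMeasure d).real Set.univ)⁻¹ *
      ∫ u, tent (inner ℝ (u : Space d) x) ∂(sphereMeasure d) := funext phi_eq
  rw [this]
  refine continuous_const.mul (continuous_of_dominated (bound := fun _ => 1) (fun x => ?_)
    (fun x => ae_of_all _ fun u => abs_tent_le_one _) (integrable_const _)
    (ae_of_all _ fun u => continuous_tent.comp (by fun_prop)))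
  exact (integrable_tent_inner x).aestronglyMeasurable

theorem phi_nonneg {d : ℕ} (x : Space d) : 0 ≤ phi d x := by
  rw [phi_eq]
  exact mul_nonneg (by positivity) (integral_nonneg fun u => tent_nonneg _)

theorem antitoneOn_phi_smul {d : ℕ} (x : Space d) :
    AntitoneOn (fun r : ℝ => phi d (r • x)) (Set.Ici 0) := by
  intro r hr s hs hrs
  simp only [phi_eq]
  refine mul_le_mul_of_nonneg_left (integral_mono (integrable_tent_inner _)
    (integrable_tent_inner _) fun u => ?_) (by positivity)
  simp only [inner_smul_right, tent, abs_mul, abs_of_nonneg (Set.mem_Ici.1 hr),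
    abs_of_nonneg (Set.mem_Ici.1 hs)]
  gcongr

theorem convexOn_phi_smul {d : ℕ} (x : Space d) :
    ConvexOn ℝ (Set.Ici 0) fun r : ℝ => phi d (r • x) := by
  refine ⟨convex_Ici 0, fun r hr s hs a b ha hb hab => ?_⟩
  have hr' : 0 ≤ r := hr
  have hs' : 0 ≤ s := hs
  have hc : 0 ≤ ((sphereMeasure d).real Set.univ)⁻¹ := by positivity
  simp only [phi_eq, smul_eq_mul]
  rw [mul_left_comm a, mul_left_comm b, ← mul_add]
  refine mul_le_mul_of_nonneg_left ?_ hc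
  rw [← integral_const_mul, ← integral_const_mul,
    ← integral_add ((integrable_tent_inner _).const_mul a) ((integrable_tent_inner _).const_mul b)]
  refine integral_mono (integrable_tent_inner _)
    (((integrable_tent_inner _).const_mul a).add ((integrable_tent_inner _).const_mul b))
    fun u => ?_
  simp only [inner_smul_right, tent, abs_mul, abs_of_nonneg hr', abs_of_nonneg hs',
    abs_of_nonneg (add_nonneg (mul_nonneg ha hr') (mul_nonneg hb hs'))]
  generalize |inner ℝ (u : Space d) x| = q
  refine max_le ?_ (by positivity)
  calc 1 - (a * r + b * s) * q = a * (1 - r * q) + b * (1 - s * q) := by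
        linear_combination (-1 : ℝ) * hab
    _ ≤ _ := by gcongr <;> exact le_max_left _ _

end Polar

/-! ### The function `h_d` -/

section HFun

/-- The multiplicative constant in the definition of `h_d`. -/
noncomputable def hConst (d : ℕ) : ℝ :=
  d * Real.Gamma (d / 2) / (Real.sqrt Real.pi * Real.Gamma ((d + 1) / 2))

theorem hConst_nonneg (d : ℕ) : 0 ≤ hConst d := by
  unfold hConst
  have h1 : 0 ≤ Real.Gamma ((d : ℝ) / 2) := Real.Gamma_nonneg_of_nonneg (by positivity)
  have h2 : 0 ≤ Real.Gamma (((d : ℝ) + 1) / 2) := Real.Gamma_nonneg_of_nonneg (by positivity)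
  positivity

theorem hFun_eq_zero {d : ℕ} {t : ℝ} (ht : 1 ≤ t) : hFun d t = 0 := by
  simp [hFun, Set.Ioc_eq_empty_of_le ht]

/-- The continuous function `(1 - v²)^((d-1)/2)`. -/
noncomputable def hDensity (d : ℕ) (v : ℝ) : ℝ := (1 - v ^ 2) ^ (((d : ℝ) - 1) / 2)

theorem continuous_hDensity {d : ℕ} (hd : 1 ≤ d) : Continuous (hDensity d) := by
  have : (0 : ℝ) ≤ ((d : ℝ) - 1) / 2 := by
    have : (1 : ℝ) ≤ d := by exact_mod_cast hd
    linarith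
  exact (Real.continuous_rpow_const this).comp (by fun_prop)

theorem hFun_eq_intervalIntegral (d : ℕ) (t : ℝ) :
    hFun d t = hConst d * ∫ v in (min t 1)..1, hDensity d v := by
  rw [hFun, hConst, intervalIntegral.integral_of_le (min_le_right _ _)]
  congr 2
  rcases le_total t 1 with h | h
  · rw [min_eq_left h]
  · rw [min_eq_right h, Set.Ioc_self, Set.Ioc_eq_empty_of_le h]

theorem continuous_hFun {d : ℕ} (hd : 1 ≤ d) : Continuous (hFun d) := by
  have : hFun d = fun t => hConst d * ∫ v in (min t 1)..1, hDensity d v :=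
    funext (hFun_eq_intervalIntegral d)
  rw [this]
  have hc : Continuous fun s : ℝ => ∫ v in s..1, hDensity d v := by
    have h1 : Continuous fun s : ℝ => ∫ v in (1 : ℝ)..s, hDensity d v :=
      intervalIntegral.continuous_primitive
        (fun a b => (continuous_hDensity hd).intervalIntegrable a b) 1
    refine h1.neg.congr fun s => ?_
    exact (intervalIntegral.integral_symm _ _).symm
  exact continuous_const.mul (hc.comp (continuous_id.min continuous_const))

/-- The density `(1 - v²)^((d-1)/2)` on `v ≤ 1`, continued by zero. -/
noncomputable def hCutoff (d : ℕ) : ℝ → ℝ := (Set.Iic 1).indicator (hDensity d)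

theorem antitoneOn_hCutoff {d : ℕ} (hd : 1 ≤ d) : AntitoneOn (hCutoff d) (Set.Ici 0) := by
  intro x (hx : 0 ≤ x) y (hy : 0 ≤ y) hxy
  have he : (0 : ℝ) ≤ ((d : ℝ) - 1) / 2 := by
    have : (1 : ℝ) ≤ d := by exact_mod_cast hd
    linarith
  unfold hCutoff
  by_cases hy1 : y ≤ 1
  · rw [Set.indicator_of_mem (show y ∈ Set.Iic 1 from hy1),
      Set.indicator_of_mem (show x ∈ Set.Iic 1 from hxy.trans hy1)]
    exact Real.rpow_le_rpow (by nlinarith) (by nlinarith) he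
  · rw [Set.indicator_of_notMem (show y ∉ Set.Iic 1 from hy1)]
    refine Set.indicator_apply_nonneg fun hx1 => Real.rpow_nonneg ?_ _
    have : x ≤ 1 := hx1
    nlinarith

theorem intervalIntegrable_hCutoff {d : ℕ} (hd : 1 ≤ d) (a b : ℝ) :
    IntervalIntegrable (hCutoff d) volume a b := by
  have h := (continuous_hDensity hd).intervalIntegrable (μ := volume) a b
  exact ⟨h.1.indicator measurableSet_Iic, h.2.indicator measurableSet_Iic⟩

theorem hFun_sub_hFun {d : ℕ} (hd : 1 ≤ d) {s t : ℝ} (hst : s ≤ t) :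
    hFun d s - hFun d t = hConst d * ∫ v in s..t, hCutoff d v := by
  -- The cutoff vanishes beyond 1, so the upper limit may be any `M` past both `r` and 1. A common
  -- `M` for `s` and `t` makes the difference a single integral.
  have key : ∀ r : ℝ, ∀ M, max r 1 ≤ M → hFun d r = hConst d * ∫ v in r..M, hCutoff d v := by
    intro r M hM
    have hr : r ≤ M := (le_max_left _ _).trans hM
    have h1 : (1 : ℝ) ≤ M := (le_max_right _ _).trans hM
    rw [intervalIntegral.integral_of_le hr, hCutoff, setIntegral_indicator measurableSet_Iic,
      Set.Ioc_inter_Iic, min_eq_right h1, hFun, hConst]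
    rfl
  set M := max t 1 with hM
  rw [key t M le_rfl, key s M (max_le_max hst le_rfl),
    ← intervalIntegral.integral_add_adjacent_intervals (intervalIntegrable_hCutoff hd s t)
      (intervalIntegrable_hCutoff hd t M)]
  ring

theorem hCutoff_nonneg (d : ℕ) {v : ℝ} (hv : 0 ≤ v) : 0 ≤ hCutoff d v := by
  refine Set.indicator_apply_nonneg fun hv1 => Real.rpow_nonneg ?_ _
  have : v ≤ 1 := hv1
  nlinarith

theorem antitoneOn_hFun {d : ℕ} (hd : 1 ≤ d) : AntitoneOn (hFun d) (Set.Ici 0) := by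
  intro s hs t _ hst
  rw [← sub_nonneg, hFun_sub_hFun hd hst]
  exact mul_nonneg (hConst_nonneg d) (intervalIntegral.integral_nonneg hst fun v hv =>
    hCutoff_nonneg d (le_trans hs hv.1))

theorem hFun_nonneg {d : ℕ} (hd : 1 ≤ d) {t : ℝ} (ht : 0 ≤ t) : 0 ≤ hFun d t := by
  have h := antitoneOn_hFun hd ht (Set.mem_Ici.2 (le_max_of_le_left ht)) (le_max_left t 1)
  rwa [hFun_eq_zero (le_max_right t 1)] at h

/-- The slope of `hFun` is minus a nonnegative constant times the nonincreasing `hCutoff`. The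
decrease over `[x, z]` and over `[z, y]` is compared with the value of `hCutoff` at the intermediate
point `z`. -/
theorem convexOn_hFun {d : ℕ} (hd : 1 ≤ d) : ConvexOn ℝ (Set.Ici 0) (hFun d) := by
  refine LinearOrder.convexOn_of_lt (convex_Ici 0) fun x hx y hy hxy a b ha hb hab => ?_
  have hx' : 0 ≤ x := hx
  simp only [smul_eq_mul]
  set z := a * x + b * y with hz
  have hxz : x ≤ z := by nlinarith
  have hzy : z ≤ y := by nlinarith
  have hz0 : 0 ≤ z := hx'.trans hxz
  have h1 : hCutoff d z * (z - x) ≤ ∫ v in x..z, hCutoff d v := by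
    have := intervalIntegral.integral_mono_on hxz (intervalIntegrable_const (c := hCutoff d z))
      (intervalIntegrable_hCutoff hd x z) fun v hv =>
        antitoneOn_hCutoff hd (Set.mem_Ici.2 (hx'.trans hv.1)) (Set.mem_Ici.2 hz0) hv.2
    rwa [intervalIntegral.integral_const, smul_eq_mul, mul_comm] at this
  have h2 : ∫ v in z..y, hCutoff d v ≤ hCutoff d z * (y - z) := by
    have := intervalIntegral.integral_mono_on hzy (intervalIntegrable_hCutoff hd z y)
      (intervalIntegrable_const (c := hCutoff d z)) fun v hv =>
        antitoneOn_hCutoff hd (Set.mem_Ici.2 hz0) (Set.mem_Ici.2 (hz0.trans hv.1)) hv.1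
    rwa [intervalIntegral.integral_const, smul_eq_mul, mul_comm (y - z)] at this
  have e1 := hFun_sub_hFun hd hxz
  have e2 := hFun_sub_hFun hd hzy
  have h3 := mul_le_mul_of_nonneg_left (mul_le_mul_of_nonneg_left h1 ha.le) (hConst_nonneg d)
  have h4 := mul_le_mul_of_nonneg_left (mul_le_mul_of_nonneg_left h2 hb.le) (hConst_nonneg d)
  have h5 : a * (z - x) = b * (y - z) := by
    have hb' : b = 1 - a := by linarith
    rw [hz, hb']
    ring
  have h6 : hConst d * (a * (hCutoff d z * (z - x))) = hConst d * (b * (hCutoff d z * (y - z))) := by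
    rw [mul_left_comm a, h5]
    ring
  have h7 : b * (hFun d z - hFun d y) ≤ a * (hFun d x - hFun d z) := by
    rw [e1, e2]
    calc _ = hConst d * (b * ∫ v in z..y, hCutoff d v) := by ring
      _ ≤ hConst d * (a * ∫ v in x..z, hCutoff d v) := h4.trans (h6.symm.le.trans h3)
      _ = _ := by ring
  have h8 : hFun d z = a * hFun d z + b * hFun d z := by rw [← add_mul, hab, one_mul]
  linarith

end HFun

/-! ### Regularity of `χ_d` -/

section Chi

theorem continuous_chi {d : ℕ} (hd : 1 ≤ d) : Continuous (chi d) :=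
  ((continuous_phi d).comp (continuous_const_smul (2 : ℝ))).mul
    ((continuous_hFun hd).comp continuous_norm)

theorem chi_eq_zero {d : ℕ} {x : Space d} (hx : 1 ≤ ‖x‖) : chi d x = 0 := by
  rw [chi, hFun_eq_zero hx, mul_zero]

theorem chi_radial {d : ℕ} (hd : 1 ≤ d) : ∃ c : ℝ → ℝ, (∀ x, chi d x = c ‖x‖) ∧
    ConvexOn ℝ (Set.Ici 0) c ∧ Tendsto c atTop (𝓝 0) := by
  -- Norm 2 absorbs the argument doubling in `φ_d(2t)`: `r • e` has the norm of `2 • x` when `r =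
  -- ‖x‖`.
  set e : Space d := EuclideanSpace.single ⟨0, hd⟩ 2 with he
  have hnorm : ‖e‖ = 2 := by simp [he]
  refine ⟨fun r => phi d (r • e) * hFun d r, fun x => ?_, ?_, ?_⟩
  · rw [chi, phi_eq_of_norm_eq hd]
    simp [norm_smul, hnorm, mul_comm]
  -- A product of nonnegative convex functions is convex when they vary in the same direction; here
  -- both are nonincreasing.
  · exact (convexOn_phi_smul e).mul (convexOn_hFun hd) (fun r _ => phi_nonneg _)
      (fun r hr => hFun_nonneg hd hr) ((antitoneOn_phi_smul e).monovaryOn (antitoneOn_hFun hd))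
  · refine tendsto_const_nhds.congr' ?_
    filter_upwards [eventually_ge_atTop 1] with r hr
    rw [hFun_eq_zero hr, mul_zero]

end Chi

/-! ### A stationary max-stable process with tail correlation function `χ_d` -/

section Construction

variable {d : ℕ}

/-- The uniform probability distribution on the unit sphere. -/
noncomputable def uniformSphere (d : ℕ) : Measure (Metric.sphere (0 : Space d) 1) :=
  (sphereMeasure d Set.univ)⁻¹ • sphereMeasure d

theorem isProbabilityMeasure_uniformSphere (hd : 1 ≤ d) :
    IsProbabilityMeasure (uniformSphere d) := by
  have : Nonempty (Fin d) := ⟨⟨0, hd⟩⟩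
  have : NeZero (sphereMeasure d) := ⟨Measure.toSphere_ne_zero _⟩
  unfold uniformSphere
  infer_instance

instance : IsFiniteMeasure (uniformSphere d) := by
  unfold uniformSphere
  infer_instance

theorem lintegral_tent_uniformSphere (x : Space d) :
    ∫⁻ u, ENNReal.ofReal (tent (inner ℝ (u : Space d) x)) ∂(uniformSphere d) =
      ENNReal.ofReal (phi d x) := by
  have hint : Integrable (fun u : Metric.sphere (0 : Space d) 1 => tent (inner ℝ (u : Space d) x))
      (uniformSphere d) := by
    refine Integrable.of_bound (C := 1) ?_ (ae_of_all _ fun u => abs_tent_le_one _)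
    exact (continuous_tent.comp (by fun_prop)).aestronglyMeasurable
  rw [← ofReal_integral_eq_lintegral_ofReal hint (ae_of_all _ fun u => tent_nonneg _)]
  rfl

/-- The mark space: a direction, a position on the line and a position in space. -/
abbrev Mark (d : ℕ) : Type := Metric.sphere (0 : Space d) 1 × (ℝ × Space d)

/-- The intensity measure on the mark space. -/
noncomputable def markMeasure (d : ℕ) : Measure (Mark d) :=
  (uniformSphere d).prod ((volume : Measure ℝ).prod (volume : Measure (Space d)))

instance : SigmaFinite (markMeasure d) := by
  unfold markMeasure
  infer_instance

/-- The marks whose slab orthogonal to the direction and whose ball both contain `t`. -/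
def markSet (t : Space d) : Set (Mark d) :=
  {p | |p.2.1 - inner ℝ (p.1 : Space d) t| ≤ 1 / 4 ∧ ‖p.2.2 - t‖ ≤ 1 / 2}

theorem measurableSet_markSet (t : Space d) : MeasurableSet (markSet t) := by
  have h1 : Continuous fun p : Mark d => |p.2.1 - inner ℝ (p.1 : Space d) t| := by fun_prop
  have h2 : Continuous fun p : Mark d => ‖p.2.2 - t‖ := by fun_prop
  exact (measurableSet_le h1.measurable measurable_const).inter
    (measurableSet_le h2.measurable measurable_const)

/-- The spectral functions of the process with tail correlation function `χ_d`. -/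
noncomputable def markSpectral (t : Space d) : Mark d → ℝ≥0∞ :=
  (markSet t).indicator fun _ => 2 / volume (Metric.closedBall (0 : Space d) (1 / 2))

theorem measurable_markSpectral (t : Space d) : Measurable (markSpectral t) :=
  measurable_const.indicator (measurableSet_markSet t)

/-- The shift of the mark space that corresponds to a translation of `ℝ^d`. -/
noncomputable def markShift (h : Space d) (p : Mark d) : Mark d :=
  (p.1, (p.2.1 + inner ℝ (p.1 : Space d) h, p.2.2 + h))

/-- For each fixed direction the map is a translation of `ℝ × ℝ^d`, so it is a skew product over the
identity on the sphere. -/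
theorem measurePreserving_markShift (h : Space d) :
    MeasurePreserving (markShift h) (markMeasure d) (markMeasure d) := by
  refine (MeasurePreserving.id (uniformSphere d)).skew_product
    (g := fun u (q : ℝ × Space d) => (q.1 + inner ℝ (u : Space d) h, q.2 + h)) ?_
    (ae_of_all _ fun u => ?_)
  · have : Continuous fun p : Mark d => (p.2.1 + inner ℝ (p.1 : Space d) h, p.2.2 + h) := by
      fun_prop
    exact this.measurable
  · exact ((measurePreserving_add_right volume (inner ℝ (u : Space d) h)).prod
      (measurePreserving_add_right volume h)).map_eq

theorem markSpectral_markShift (t h : Space d) (p : Mark d) :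
    markSpectral (t + h) (markShift h p) = markSpectral t p := by
  have : markShift h p ∈ markSet (t + h) ↔ p ∈ markSet t := by
    simp [markSet, markShift, inner_add_right]
  unfold markSpectral
  by_cases hp : p ∈ markSet t
  · rw [Set.indicator_of_mem hp, Set.indicator_of_mem (this.2 hp)]
  · rw [Set.indicator_of_notMem hp, Set.indicator_of_notMem (mt this.1 hp)]

theorem volume_slab_inter (a : ℝ) :
    volume ({z : ℝ | |z - 0| ≤ 1 / 4} ∩ {z | |z - a| ≤ 1 / 4}) =
      ENNReal.ofReal (tent (2 * a) / 2) := by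
  have h : ∀ b : ℝ, {z : ℝ | |z - b| ≤ 1 / 4} = Set.Icc (b - 1 / 4) (b + 1 / 4) := by
    intro b
    ext z
    simp only [Set.mem_ofPred_eq, Set.mem_Icc, abs_le]
    constructor <;> rintro ⟨h1, h2⟩ <;> constructor <;> linarith
  rw [h, h, Set.Icc_inter_Icc, Real.volume_Icc, tent, abs_mul, abs_two]
  rcases le_total 0 a with ha | ha
  · rw [abs_of_nonneg ha, min_eq_left (by linarith), max_eq_right (by linarith)]
    rcases le_total (1 - 2 * a) 0 with h1 | h1
    · rw [max_eq_right h1, ENNReal.ofReal_of_nonpos (by linarith)]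
      simp
    · rw [max_eq_left h1]
      congr 1
      ring
  · rw [abs_of_nonpos ha, min_eq_right (by linarith), max_eq_left (by linarith)]
    rcases le_total (1 - 2 * -a) 0 with h1 | h1
    · rw [max_eq_right h1, ENNReal.ofReal_of_nonpos (by linarith)]
      simp
    · rw [max_eq_left h1]
      congr 1
      ring

/-- For fixed `u` the common marks form a product set. Slab half-width 1/4 makes the interval
overlap `tent (2a) / 2` with `a = ⟨u, t⟩`, and radius 1/2 makes the ball overlap `B * h_d(‖t‖)`. The
weight `2 / B` cancels the constants, and the average over `u` produces `φ_d(2t)`. -/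
theorem lintegral_min_markSpectral (hd : 1 ≤ d) (t : Space d) :
    ∫⁻ p, min (markSpectral 0 p) (markSpectral t p) ∂(markMeasure d) =
      ENNReal.ofReal (chi d t) := by
  obtain ⟨n, rfl⟩ : ∃ n, d = n + 1 := ⟨d - 1, by omega⟩
  set B := volume (Metric.closedBall (0 : Space (n + 1)) (1 / 2)) with hB
  have hB0 : B ≠ 0 := (Metric.measure_closedBall_pos _ _ (by norm_num)).ne'
  have hBt : B ≠ ∞ := measure_closedBall_lt_top.ne
  have hmin : ∀ p : Mark (n + 1), min (markSpectral 0 p) (markSpectral t p) =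
      (markSet 0 ∩ markSet t).indicator (fun _ => 2 / B) p := by
    intro p
    unfold markSpectral
    by_cases h0 : p ∈ markSet (0 : Space (n + 1)) <;> by_cases h1 : p ∈ markSet t <;>
      simp [h0, h1, hB]
  have hm := (measurableSet_markSet (0 : Space (n + 1))).inter (measurableSet_markSet t)
  simp only [hmin]
  rw [lintegral_indicator_const hm, markMeasure, Measure.prod_apply hm]
  have hsec : ∀ u : Metric.sphere (0 : Space (n + 1)) 1,
      ((volume : Measure ℝ).prod (volume : Measure (Space (n + 1))))
        (Prod.mk u ⁻¹' (markSet 0 ∩ markSet t)) =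
      ENNReal.ofReal (tent (inner ℝ (u : Space (n + 1)) ((2 : ℝ) • t))) *
        (2⁻¹ * (B * ENNReal.ofReal (hFun (n + 1) ‖t‖))) := by
    intro u
    have hset : Prod.mk u ⁻¹' (markSet 0 ∩ markSet t) =
        ({z : ℝ | |z - 0| ≤ 1 / 4} ∩ {z | |z - inner ℝ (u : Space (n + 1)) t| ≤ 1 / 4}) ×ˢ
          (Metric.closedBall (0 : Space (n + 1)) (1 / 2) ∩ Metric.closedBall t (1 / 2)) := by
      ext p
      simp only [markSet, Set.mem_preimage, Set.mem_inter_iff, Set.mem_ofPred_eq, inner_zero_right,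
        Set.mem_prod, mem_closedBall_iff_norm]
      tauto
    have htent : 0 ≤ tent (2 * inner ℝ (u : Space (n + 1)) t) := tent_nonneg _
    rw [hset, Measure.prod_prod, volume_slab_inter,
      volume_closedBall_inter_closedBall n t (by norm_num), inner_smul_right, ← hB,
      div_eq_mul_inv, ENNReal.ofReal_mul htent, ENNReal.ofReal_inv_of_pos two_pos,
      ENNReal.ofReal_ofNat, mul_assoc]
    norm_num
  simp only [hsec]
  have hmeas : Measurable fun u : Metric.sphere (0 : Space (n + 1)) 1 =>
      ENNReal.ofReal (tent (inner ℝ (u : Space (n + 1)) ((2 : ℝ) • t))) :=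
    ENNReal.measurable_ofReal.comp (continuous_tent.comp (by fun_prop)).measurable
  rw [lintegral_mul_const _ hmeas, lintegral_tent_uniformSphere, chi,
    ENNReal.ofReal_mul (phi_nonneg _)]
  calc _ = (2 * 2⁻¹) * (B * B⁻¹) * (ENNReal.ofReal (phi (n + 1) ((2 : ℝ) • t)) *
        ENNReal.ofReal (hFun (n + 1) ‖t‖)) := by
        rw [div_eq_mul_inv]
        ring
    _ = _ := by
        rw [ENNReal.mul_inv_cancel hB0 hBt, ENNReal.mul_inv_cancel two_ne_zero (by simp), one_mul,
          one_mul]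

theorem chi_zero (hd : 1 ≤ d) : chi d 0 = 1 := by
  obtain ⟨n, rfl⟩ : ∃ n, d = n + 1 := ⟨d - 1, by omega⟩
  have := isProbabilityMeasure_uniformSphere hd
  have hphi : phi (n + 1) 0 = 1 := by
    have h := lintegral_tent_uniformSphere (0 : Space (n + 1))
    simpa [tent] using h.symm
  simp [chi, hphi, hFun_zero]

theorem lintegral_markSpectral (hd : 1 ≤ d) (t : Space d) :
    ∫⁻ p, markSpectral t p ∂(markMeasure d) = 1 := by
  have h0 : ∫⁻ p, markSpectral (0 : Space d) p ∂(markMeasure d) = 1 := by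
    have := lintegral_min_markSpectral hd (0 : Space d)
    simpa [chi_zero hd] using this
  rw [← (measurePreserving_markShift t).lintegral_comp (measurable_markSpectral t), ← h0]
  refine lintegral_congr fun p => ?_
  have := markSpectral_markShift 0 t p
  rwa [zero_add] at this

theorem chi_nonneg (hd : 1 ≤ d) (t : Space d) : 0 ≤ chi d t :=
  mul_nonneg (phi_nonneg _) (hFun_nonneg hd (norm_nonneg _))

theorem chi_mem_allTCF (hd : 1 ≤ d) : chi d ∈ allTCF d := by
  obtain ⟨Ω, mΩ, P, hP, X, hX, h⟩ :=
    exists_process (markMeasure d) measurable_markSpectral (lintegral_markSpectral hd)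
  refine ⟨Ω, mΩ, P, hP, X, hX, h.stationary hX fun m t r x _ => ?_,
    h.maxStable hX, h.hasFrechetMarginals, ?_⟩
  · have hmeas : Measurable fun s => ⨆ k, markSpectral (t k + r) s / ENNReal.ofReal (x k) :=
      Measurable.iSup fun k => (measurable_markSpectral (t k + r)).div_const _
    rw [← (measurePreserving_markShift r).lintegral_comp hmeas]
    simp only [markSpectral_markShift]
  · have htcf := h.hasTCF hX
    simp only [lintegral_min_markSpectral hd, ENNReal.toReal_ofReal (chi_nonneg hd _)] at htcf
    exact htcf

theorem chi_mem_radialTCF (hd : 1 ≤ d) : chi d ∈ radialTCF d :=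
  ⟨chi_mem_allTCF hd, continuous_chi hd, chi_radial hd⟩

end Construction

/-! ### Variance-mixed Brown-Resnick processes -/

/-- The minimum of two exponentials is positive everywhere, so its integral against a probability
measure is positive. Neither the Gaussian law nor the independence of `S` plays a role. -/
theorem pos_of_mem_vbrTCF {d : ℕ} {χ : Space d → ℝ} (hχ : χ ∈ vbrTCF d) (t : Space d) :
    0 < χ t := by
  obtain ⟨Ω, mΩ, P, hP, X, hX, ⟨Ω', mΩ', Q, hQ, W, S, -, -, -, -, -, -, -, h⟩, htcf⟩ := hχ
  rw [h.eq_of_hasTCF hX htcf t]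
  refine ENNReal.toReal_pos ?_ ?_
  · refine (lintegral_pos_iff_support ((h.measurable 0).min (h.measurable t))).2 ?_ |>.ne'
    have : Function.support (fun ω => min (ENNReal.ofReal
        (Real.exp (S ω * W 0 ω - S ω ^ 2 * variance (W 0) Q / 2))) (ENNReal.ofReal
        (Real.exp (S ω * W t ω - S ω ^ 2 * variance (W t) Q / 2)))) = Set.univ := by
      refine Set.eq_univ_of_forall fun ω => ?_
      simp [Function.mem_support, Real.exp_pos]
    rw [this]
    simp
  · intro hc
    have := h.lintegral_max_add_lintegral_min 0 t
    simp [hc] at this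

theorem chi_notMem_vbrTCF {d : ℕ} (hd : 1 ≤ d) : chi d ∉ vbrTCF d := by
  intro h
  have h1 : (1 : ℝ) ≤ ‖(EuclideanSpace.single ⟨0, hd⟩ 1 : Space d)‖ := by simp
  exact (pos_of_mem_vbrTCF h _).ne' (chi_eq_zero h1)

/-! ### The functions `φ_3` and `h_3` -/

section DimensionThree

theorem hFun_three {t : ℝ} (ht : t ≤ 1) : hFun 3 t = (1 - t) ^ 2 * (2 + t) / 2 := by
  have hexp : (((3 : ℕ) : ℝ) - 1) / 2 = 1 := by norm_num
  have hG : Real.Gamma (((3 : ℕ) : ℝ) / 2) = √Real.pi / 2 := by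
    have : ((3 : ℕ) : ℝ) / 2 = 1 / 2 + 1 := by norm_num
    rw [this, Real.Gamma_add_one (by norm_num), Real.Gamma_one_half_eq]
    ring
  have hG2 : Real.Gamma ((((3 : ℕ) : ℝ) + 1) / 2) = 1 := by
    have : (((3 : ℕ) : ℝ) + 1) / 2 = 2 := by norm_num
    rw [this, Real.Gamma_two]
  have hpi : √Real.pi ≠ 0 := (Real.sqrt_pos.2 Real.pi_pos).ne'
  rw [hFun, hexp, hG, hG2]
  simp only [Real.rpow_one]
  rw [← intervalIntegral.integral_of_le ht, intervalIntegral.integral_sub (by simp) (by simp)]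
  simp only [intervalIntegral.integral_const, integral_pow, smul_eq_mul]
  push_cast
  field_simp
  ring

/-- The function whose radial average is the tent function in dimension three. -/
noncomputable def preTent (q : ℝ) : ℝ := if q ≤ 1 then 1 - 4 / 3 * q else 0

theorem measurable_preTent : Measurable preTent := by
  unfold preTent
  exact Measurable.ite measurableSet_Iic (by fun_prop) measurable_const

theorem abs_preTent_le {q : ℝ} (hq : 0 ≤ q) : |preTent q| ≤ 1 := by
  unfold preTent
  split_ifs with h
  · rw [abs_le]
    constructor <;> linarith
  · simp

theorem integral_mul_preTent_of_le (p : ℝ → ℝ) {q : ℝ} (hq : q ≤ 1) :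
    ∫ v in (0 : ℝ)..1, p v * preTent (q * v) =
      ∫ v in (0 : ℝ)..1, p v * (1 - 4 / 3 * (q * v)) := by
  refine intervalIntegral.integral_congr fun v hv => ?_
  rw [Set.uIcc_of_le zero_le_one] at hv
  have : q * v ≤ 1 := by nlinarith [hv.1, hv.2]
  simp [preTent, this]

theorem integral_mul_preTent_of_ge (p : ℝ → ℝ) {q : ℝ} (hq : 1 ≤ q) :
    ∫ v in (0 : ℝ)..1, p v * preTent (q * v) =
      ∫ v in (0 : ℝ)..q⁻¹, p v * (1 - 4 / 3 * (q * v)) := by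
  have hq0 : 0 < q := one_pos.trans_le hq
  have hle : q⁻¹ ≤ 1 := inv_le_one_of_one_le₀ hq
  rw [intervalIntegral.integral_of_le zero_le_one,
    intervalIntegral.integral_of_le (inv_nonneg.2 hq0.le),
    ← integral_indicator measurableSet_Ioc, ← integral_indicator measurableSet_Ioc]
  congr 1
  ext v
  have hiff : q * v ≤ 1 ↔ v ≤ q⁻¹ := by
    rw [← mul_one q⁻¹, le_inv_mul_iff₀ hq0]
  by_cases h0 : 0 < v
  · by_cases h1 : v ≤ q⁻¹
    · simp [h0, h1, h1.trans hle, preTent, hiff]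
    · by_cases h2 : v ≤ 1 <;> simp [h0, h1, h2, preTent, hiff]
  · simp [h0]

/-- This identity dictates `preTent`: it says `∫_0^q s² preTent(s) ds = q³ tent(q) / 3`, and
differentiation gives `1 - 4q/3` below 1 and 0 above. -/
theorem integral_sq_mul_preTent {q : ℝ} (hq : 0 ≤ q) :
    ∫ r in (0 : ℝ)..1, r ^ 2 * preTent (q * r) = tent q / 3 := by
  have hpoly : ∀ m : ℝ, ∫ r in (0 : ℝ)..m, r ^ 2 * (1 - 4 / 3 * (q * r)) =
      m ^ 3 / 3 - q * m ^ 4 / 3 := by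
    intro m
    have : ∀ r : ℝ, r ^ 2 * (1 - 4 / 3 * (q * r)) = r ^ 2 - 4 / 3 * q * r ^ 3 := fun r => by ring
    simp only [this]
    rw [intervalIntegral.integral_sub (by simp) (Continuous.intervalIntegrable (by fun_prop) _ _),
      intervalIntegral.integral_const_mul, integral_pow, integral_pow]
    push_cast
    ring
  rcases le_total q 1 with h | h
  · rw [integral_mul_preTent_of_le _ h, hpoly, tent, abs_of_nonneg hq, max_eq_left (by linarith)]
    ring
  · rw [integral_mul_preTent_of_ge _ h, hpoly, tent, abs_of_nonneg hq, max_eq_right (by linarith)]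
    field_simp
    ring

theorem integral_one_sub_sq_mul_preTent_of_le {q : ℝ} (hq : q ≤ 1) :
    ∫ v in (0 : ℝ)..1, (1 - v ^ 2) * preTent (q * v) = 2 / 3 * (1 - q / 2) := by
  rw [integral_mul_preTent_of_le _ hq]
  have : ∀ v : ℝ, (1 - v ^ 2) * (1 - 4 / 3 * (q * v)) =
      1 - v ^ 2 - 4 / 3 * q * v + 4 / 3 * q * v ^ 3 := fun v => by ring
  simp only [this]
  rw [intervalIntegral.integral_add (Continuous.intervalIntegrable (by fun_prop) _ _)
      (Continuous.intervalIntegrable (by fun_prop) _ _),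
    intervalIntegral.integral_sub (Continuous.intervalIntegrable (by fun_prop) _ _)
      (Continuous.intervalIntegrable (by fun_prop) _ _),
    intervalIntegral.integral_sub (by simp) (by simp), intervalIntegral.integral_const_mul,
    intervalIntegral.integral_const_mul, integral_pow, integral_pow, integral_id,
    intervalIntegral.integral_const]
  norm_num
  ring

theorem integral_one_sub_sq_mul_preTent_of_ge {q : ℝ} (hq : 1 ≤ q) :
    ∫ v in (0 : ℝ)..1, (1 - v ^ 2) * preTent (q * v) = 2 / 3 * (1 / (2 * q)) := by
  rw [integral_mul_preTent_of_ge _ hq]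
  have hq0 : q ≠ 0 := (one_pos.trans_le hq).ne'
  have : ∀ v : ℝ, (1 - v ^ 2) * (1 - 4 / 3 * (q * v)) =
      1 - v ^ 2 - 4 / 3 * q * v + 4 / 3 * q * v ^ 3 := fun v => by ring
  simp only [this]
  rw [intervalIntegral.integral_add (Continuous.intervalIntegrable (by fun_prop) _ _)
      (Continuous.intervalIntegrable (by fun_prop) _ _),
    intervalIntegral.integral_sub (Continuous.intervalIntegrable (by fun_prop) _ _)
      (Continuous.intervalIntegrable (by fun_prop) _ _),
    intervalIntegral.integral_sub (by simp) (by simp), intervalIntegral.integral_const_mul,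
    intervalIntegral.integral_const_mul, integral_pow, integral_pow, integral_id,
    intervalIntegral.integral_const]
  simp only [smul_eq_mul]
  push_cast
  field_simp
  ring

theorem volume_real_closedBall_two : volume (Metric.closedBall (0 : Space 2) 1) =
    ENNReal.ofReal Real.pi := by
  rw [EuclideanSpace.volume_closedBall_fin_two]
  simp [ENNReal.ofReal, Real.toNNReal_of_nonneg Real.pi_pos.le]

theorem sphereMeasure_three_real : (sphereMeasure 3).real Set.univ = 4 * Real.pi := by
  rw [Measure.toSphere_real_apply_univ, measureReal_def, EuclideanSpace.volume_ball_fin_three]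
  have : 0 ≤ Real.pi * 4 / 3 := by positivity
  simp only [ENNReal.ofReal_one, one_pow, one_mul, finrank_euclideanSpace_fin]
  rw [ENNReal.toReal_ofReal this]
  push_cast
  ring

theorem integral_preTent_closedBall {e : Space 3} (he : ‖e‖ = 1) (r : ℝ) :
    ∫ x in Metric.closedBall (0 : Space 3) 1, preTent (r * |inner ℝ e x|) =
      2 * Real.pi * ∫ v in (0 : ℝ)..1, (1 - v ^ 2) * preTent (r * v) := by
  have hin : Measurable fun x : Space 3 => inner ℝ e x := by fun_prop
  have hG : Measurable fun v : ℝ => preTent (r * |v|) := measurable_preTent.comp (by fun_prop)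
  have h1 := integral_map (μ := volume.restrict (Metric.closedBall (0 : Space 3) 1))
    hin.aemeasurable (f := fun v : ℝ => preTent (r * |v|)) hG.aestronglyMeasurable
  rw [← h1, map_inner_volume_closedBall 2 he,
    integral_withDensity_eq_integral_toReal_smul (measurable_sliceDensity 2)
      (ae_of_all _ fun v => by
        unfold sliceDensity
        exact ENNReal.mul_lt_top ENNReal.ofReal_lt_top measure_closedBall_lt_top)]
  have h2 : ∫ v in Set.Icc (-1 : ℝ) 1, (sliceDensity 2 v).toReal • preTent (r * |v|) =
      ∫ v in Set.Icc (-1 : ℝ) 1, Real.pi * ((1 - |v| ^ 2) * preTent (r * |v|)) := by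
    refine setIntegral_congr_fun measurableSet_Icc fun v hv => ?_
    have : 0 ≤ 1 - v ^ 2 := by nlinarith [hv.1, hv.2]
    simp only [sliceDensity, volume_real_closedBall_two, smul_eq_mul]
    rw [Real.sq_sqrt this, ENNReal.toReal_mul, ENNReal.toReal_ofReal this,
      ENNReal.toReal_ofReal Real.pi_pos.le, sq_abs]
    ring
  have h3 : ∫ v in Set.Icc (-1 : ℝ) 1, (1 - |v| ^ 2) * preTent (r * |v|) =
      2 * ∫ v in (0 : ℝ)..1, (1 - v ^ 2) * preTent (r * v) := by
    have := integral_comp_abs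
      (f := (Set.Iic 1).indicator fun v : ℝ => (1 - v ^ 2) * preTent (r * v))
    rw [setIntegral_indicator measurableSet_Iic, Set.Ioi_inter_Iic] at this
    rw [intervalIntegral.integral_of_le zero_le_one, ← this,
      ← integral_indicator measurableSet_Icc]
    congr 1
    ext v
    by_cases hv : |v| ≤ 1
    · simp [abs_le.1 hv, hv]
    · have : ¬(-1 ≤ v ∧ v ≤ 1) := fun h => hv (abs_le.2 h)
      simp [this, hv]
  rw [h2, integral_const_mul, h3]
  ring

/-- The integral of `preTent (r * |⟨e, x⟩|)` over the unit ball is computed twice. In polar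
coordinates it is a third of the sphere integral of the tent; by slices orthogonal to `e` it is a
one-dimensional integral with weight `1 - v²`. -/
theorem phi_three {e : Space 3} (he : ‖e‖ = 1) {r : ℝ} (hr : 0 ≤ r) :
    phi 3 (r • e) = 3 / 2 * ∫ v in (0 : ℝ)..1, (1 - v ^ 2) * preTent (r * v) := by
  have hm : Measurable fun x : Space 3 => preTent (r * |inner ℝ e x|) :=
    measurable_preTent.comp (by fun_prop)
  have hint : IntegrableOn (fun x : Space 3 => preTent (r * |inner ℝ e x|))
      (Metric.closedBall 0 1) :=
    Measure.integrableOn_of_bounded (M := 1) measure_closedBall_lt_top.ne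
      hm.aestronglyMeasurable (ae_of_all _ fun x => abs_preTent_le (by positivity))
  have h1 := integral_closedBall_polar (by norm_num : 1 ≤ 3) hint
  rw [integral_preTent_closedBall he] at h1
  have h2 : ∀ u : Metric.sphere (0 : Space 3) 1,
      ∫ s in (0 : ℝ)..1, s ^ (3 - 1) * preTent (r * |inner ℝ e (s • (u : Space 3))|) =
        tent (inner ℝ (u : Space 3) (r • e)) / 3 := by
    intro u
    have hq : 0 ≤ r * |inner ℝ e (u : Space 3)| := by positivity
    have htent : tent (inner ℝ (u : Space 3) (r • e)) = tent (r * |inner ℝ e (u : Space 3)|) := by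
      simp [tent, inner_smul_right, abs_mul, real_inner_comm]
    rw [htent, ← integral_sq_mul_preTent hq]
    refine intervalIntegral.integral_congr fun s hs => ?_
    rw [Set.uIcc_of_le zero_le_one] at hs
    simp only [inner_smul_right, abs_mul, abs_of_nonneg hs.1]
    congr 2
    ring
  simp only [h2] at h1
  rw [integral_div] at h1
  rw [phi_eq, sphereMeasure_three_real]
  generalize (∫ v in (0 : ℝ)..1, (1 - v ^ 2) * preTent (r * v)) = J at h1 ⊢
  have hpi := Real.pi_pos.ne'
  field_simp
  linarith

theorem chi_three_of_le {e : Space 3} (he : ‖e‖ = 1) {r : ℝ} (hr : 0 ≤ r) (h : r ≤ 1 / 2) :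
    chi 3 (r • e) = (1 - r) * ((1 - r) ^ 2 * (2 + r) / 2) := by
  rw [chi, smul_smul, phi_three he (by positivity),
    integral_one_sub_sq_mul_preTent_of_le (by linarith), norm_smul, he, mul_one,
    Real.norm_of_nonneg hr, hFun_three (by linarith)]
  ring

theorem chi_three_of_ge {e : Space 3} (he : ‖e‖ = 1) {r : ℝ} (h : 1 / 2 ≤ r) (h1 : r ≤ 1) :
    chi 3 (r • e) = 1 / (4 * r) * ((1 - r) ^ 2 * (2 + r) / 2) := by
  have hr : 0 ≤ r := by linarith
  rw [chi, smul_smul, phi_three he (by positivity),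
    integral_one_sub_sq_mul_preTent_of_ge (by linarith), norm_smul, he, mul_one,
    Real.norm_of_nonneg hr, hFun_three h1]
  field_simp
  ring

end DimensionThree

/-! ### Mixed moving maxima with radial monotone shapes -/

section Overlap

variable {d : ℕ}

/-- The volume of the intersection of `-A` with its translate by `t`. -/
noncomputable def overlap (A : Set (Space d)) (t : Space d) : ℝ≥0∞ :=
  volume {z : Space d | 0 - z ∈ A ∧ t - z ∈ A}

theorem overlap_univ (t : Space (d + 1)) : overlap Set.univ t = ∞ := by
  simp [overlap]

/-- A bounded radial set which is decreasing in the radius overlaps with its translates like a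
closed ball. -/
theorem overlap_eq_closedBall {A : Set (Space (d + 1))}
    (hA : ∀ x y, ‖x‖ ≤ ‖y‖ → y ∈ A → x ∈ A) (hbdd : BddAbove (norm '' A)) :
    ∃ R : ℝ, 0 ≤ R ∧ ∀ t, overlap A t =
      volume (Metric.closedBall (0 : Space (d + 1)) R ∩ Metric.closedBall t R) := by
  -- For empty `A` radius 0 works, because a point is null in positive dimension.
  rcases A.eq_empty_or_nonempty with rfl | hne
  · refine ⟨0, le_rfl, fun t => ?_⟩
    have h0 : volume (Metric.closedBall (0 : Space (d + 1)) 0 ∩ Metric.closedBall t 0) = 0 :=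
      measure_mono_null Set.inter_subset_left (by simp)
    rw [h0]
    simp [overlap]
  set R := sSup (norm '' A) with hR
  have hle : ∀ x ∈ A, ‖x‖ ≤ R := fun x hx => le_csSup hbdd ⟨x, hx, rfl⟩
  have hlt : ∀ x : Space (d + 1), ‖x‖ < R → x ∈ A := by
    intro x hx
    obtain ⟨_, ⟨y, hy, rfl⟩, hxy⟩ := exists_lt_of_lt_csSup (hne.image _) hx
    exact hA x y hxy.le hy
  obtain ⟨x0, hx0⟩ := hne
  refine ⟨R, (norm_nonneg x0).trans (hle x0 hx0), fun t => le_antisymm ?_ ?_⟩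
  · refine measure_mono fun z hz => ⟨?_, ?_⟩
    · simpa using hle _ hz.1
    · simpa [dist_eq_norm, norm_sub_rev] using hle _ hz.2
  -- `A` contains the open ball of radius `R`, so only points on the two bounding spheres can be
  -- missing, and these are null.
  · have hsub : Metric.closedBall (0 : Space (d + 1)) R ∩ Metric.closedBall t R ⊆
        {z | 0 - z ∈ A ∧ t - z ∈ A} ∪ (Metric.sphere 0 R ∪ Metric.sphere t R) := by
      rintro z ⟨h1, h2⟩
      by_cases h3 : z ∈ Metric.sphere (0 : Space (d + 1)) R
      · exact Or.inr (Or.inl h3)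
      by_cases h4 : z ∈ Metric.sphere t R
      · exact Or.inr (Or.inr h4)
      refine Or.inl ⟨hlt _ ?_, hlt _ ?_⟩
      · have := lt_of_le_of_ne (Metric.mem_closedBall.1 h1) h3
        simpa using this
      · have := lt_of_le_of_ne (Metric.mem_closedBall.1 h2) h4
        rwa [dist_eq_norm, norm_sub_rev] at this
    refine (measure_mono hsub).trans ((measure_union_le _ _).trans ?_)
    rw [measure_union_null (Measure.addHaar_sphere _ _ _) (Measure.addHaar_sphere _ _ _), add_zero]
    rfl

theorem eq_univ_of_not_bddAbove {A : Set (Space d)} (hA : ∀ x y, ‖x‖ ≤ ‖y‖ → y ∈ A → x ∈ A)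
    (hbdd : ¬BddAbove (norm '' A)) : A = Set.univ := by
  refine Set.eq_univ_of_forall fun x => ?_
  obtain ⟨_, ⟨y, hy, rfl⟩, hxy⟩ := not_bddAbove_iff.1 hbdd ‖x‖
  exact hA x y hxy.le hy

/-- The volume of the intersection of two balls of diameter `s` at distance `τ` in `ℝ³`, up to a
constant. -/
noncomputable def lens (s τ : ℝ) : ℝ := if τ ≤ s then (s - τ) ^ 2 * (2 * s + τ) else 0

theorem lens_nonneg {s τ : ℝ} (hs : 0 ≤ s) (hτ : 0 ≤ τ) : 0 ≤ lens s τ := by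
  unfold lens
  split_ifs <;> positivity

theorem volume_lens {e : Space 3} (he : ‖e‖ = 1) {R τ : ℝ} (hR : 0 < R) (hτ : 0 ≤ τ) :
    volume (Metric.closedBall (0 : Space 3) R ∩ Metric.closedBall (τ • e) R) =
      ENNReal.ofReal (Real.pi / 12 * lens (2 * R) τ) := by
  rw [volume_closedBall_inter_closedBall 2 _ hR, EuclideanSpace.volume_closedBall_fin_three,
    norm_smul, he, mul_one, Real.norm_of_nonneg hτ, ← ENNReal.ofReal_pow hR.le,
    ← ENNReal.ofReal_mul (by positivity), ← ENNReal.ofReal_mul (by positivity)]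
  congr 1
  unfold lens
  split_ifs with h
  · rw [hFun_three (by rw [div_le_one (by positivity)]; exact h)]
    field_simp
    ring
  · rw [hFun_eq_zero (by rw [one_le_div (by positivity)]; linarith)]
    simp

/-- The monotonicity of `h''(τ)/τ`, in terms of second differences. -/
theorem lens_inequality (s : ℝ) :
    102 * lens s (49 / 100) + 49 * lens s (52 / 100) ≤
      51 * lens s (48 / 100) + 2 * lens s (50 / 100) + 98 * lens s (51 / 100) := by
  -- Let `D(τ)` be the second difference of `lens s` at `τ` with step 1/100. The claim is `51
  -- D(0.49) ≥ 49 D(0.51)`, that is `D(0.49)/0.49 ≥ D(0.51)/0.51`, rearranged so that all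
  -- coefficients are positive. The cases record which terms are cut off.
  unfold lens
  rcases lt_or_ge s (48 / 100) with h48 | h48
  · rw [if_neg (by linarith), if_neg (by linarith), if_neg (by linarith), if_neg (by linarith),
      if_neg (by linarith)]
    norm_num
  rcases lt_or_ge s (49 / 100) with h49 | h49
  · rw [if_neg (by linarith), if_neg (by linarith), if_pos (by linarith), if_neg (by linarith),
      if_neg (by linarith)]
    have : 0 ≤ (s - 48 / 100) ^ 2 * (2 * s + 48 / 100) := by positivity
    linarith
  rcases lt_or_ge s (50 / 100) with h50 | h50
  · rw [if_pos (by linarith), if_neg (by linarith), if_pos (by linarith), if_neg (by linarith),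
      if_neg (by linarith)]
    nlinarith [mul_nonneg (sub_nonneg.2 h49) (sub_nonneg.2 h50.le),
      mul_nonneg (mul_nonneg (sub_nonneg.2 h49) (sub_nonneg.2 h49)) (sub_nonneg.2 h50.le)]
  rcases lt_or_ge s (51 / 100) with h51 | h51
  · rw [if_pos (by linarith), if_neg (by linarith), if_pos (by linarith), if_pos (by linarith),
      if_neg (by linarith)]
    nlinarith [mul_nonneg (sub_nonneg.2 h50) (sub_nonneg.2 h51.le),
      mul_nonneg (mul_nonneg (sub_nonneg.2 h50) (sub_nonneg.2 h50)) (sub_nonneg.2 h51.le)]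
  -- Without cutoff, `lens s τ = 2s³ - 3s²τ + τ³` has second differences proportional to `τ`, so
  -- equality holds. If only the term at 0.52 is cut off, the left side loses a nonnegative amount.
  rcases lt_or_ge s (52 / 100) with h52 | h52
  · rw [if_pos (by linarith), if_neg (by linarith), if_pos (by linarith), if_pos (by linarith),
      if_pos (by linarith)]
    have : 0 ≤ (s - 52 / 100) ^ 2 * (2 * s + 52 / 100) := by positivity
    linarith
  · rw [if_pos (by linarith), if_pos (by linarith), if_pos (by linarith), if_pos (by linarith),
      if_pos (by linarith)]
    linarith

/-- A bounded superlevel set reduces to `lens_inequality`. An unbounded one is the whole space,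
where both sides are `∞`; having only positive coefficients keeps the inequality meaningful there.
-/
theorem overlap_inequality {A : Set (Space 3)} (hA : ∀ x y, ‖x‖ ≤ ‖y‖ → y ∈ A → x ∈ A)
    {e : Space 3} (he : ‖e‖ = 1) :
    102 * overlap A ((49 / 100 : ℝ) • e) + 49 * overlap A ((52 / 100 : ℝ) • e) ≤
      51 * overlap A ((48 / 100 : ℝ) • e) + 2 * overlap A ((50 / 100 : ℝ) • e) +
        98 * overlap A ((51 / 100 : ℝ) • e) := by
  by_cases hbdd : BddAbove (norm '' A)
  · obtain ⟨R, hR, h⟩ := overlap_eq_closedBall hA hbdd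
    rcases hR.eq_or_lt with rfl | hR
    · have hz : ∀ t, overlap A t = 0 := fun t => by
        rw [h]
        exact measure_mono_null Set.inter_subset_left (by simp)
      simp [hz]
    · have hn : ∀ {c τ : ℝ}, 0 ≤ c → 0 ≤ τ → 0 ≤ c * (Real.pi / 12 * lens (2 * R) τ) :=
        fun hc hτ => mul_nonneg hc (mul_nonneg (by positivity) (lens_nonneg (by positivity) hτ))
      have key : ∀ (c : ℕ) [c.AtLeastTwo] (τ : ℝ), 0 ≤ τ → (OfNat.ofNat c : ℝ≥0∞) *
          overlap A (τ • e) = ENNReal.ofReal (c * (Real.pi / 12 * lens (2 * R) τ)) := by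
        intro c _ τ hτ
        rw [h, volume_lens he hR hτ, ENNReal.ofReal_mul c.cast_nonneg, ENNReal.ofReal_natCast]
        rfl
      rw [key 102 _ (by norm_num), key 49 _ (by norm_num), key 51 _ (by norm_num),
        key 2 _ (by norm_num), key 98 _ (by norm_num),
        ← ENNReal.ofReal_add (hn (by positivity) (by norm_num)) (hn (by positivity) (by norm_num)),
        ← ENNReal.ofReal_add (hn (by positivity) (by norm_num)) (hn (by positivity) (by norm_num)),
        ← ENNReal.ofReal_add (add_nonneg (hn (by positivity) (by norm_num))
          (hn (by positivity) (by norm_num))) (hn (by positivity) (by norm_num))]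
      refine ENNReal.ofReal_le_ofReal ?_
      have := mul_le_mul_of_nonneg_left (lens_inequality (2 * R))
        (by positivity : 0 ≤ Real.pi / 12)
      push_cast
      linarith
  · rw [eq_univ_of_not_bddAbove hA hbdd]
    simp [overlap_univ]

end Overlap

/-! ### Layer-cake decomposition of M3r tail correlation functions -/

section M3r

variable {d : ℕ} {F : Type} [MeasurableSpace F] {Q : Measure F} [IsProbabilityMeasure Q]
  {f : F → Space d → ℝ≥0∞}

/-- The positions, shapes and levels at which the shape centred at the position exceeds the level
at both `0` and `t`. -/
def exceedSet (f : F → Space d → ℝ≥0∞) (t : Space d) : Set (Space d × (F × ℝ)) :=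
  {p | ENNReal.ofReal p.2.2 < f p.2.1 (0 - p.1) ∧ ENNReal.ofReal p.2.2 < f p.2.1 (t - p.1)}

theorem measurableSet_exceedSet (hf : Measurable fun p : F × Space d => f p.1 p.2) (t : Space d) :
    MeasurableSet (exceedSet f t) := by
  have h : ∀ s : Space d, MeasurableSet
      {p : Space d × (F × ℝ) | ENNReal.ofReal p.2.2 < f p.2.1 (s - p.1)} := by
    intro s
    have hmap : Measurable fun p : Space d × (F × ℝ) => (p.2.1, s - p.1) := by fun_prop
    exact measurableSet_lt (by fun_prop) (hf.comp hmap)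
  exact (h 0).inter (h t)

/-- The minimum of two values is the length of the set of positive levels below both. Exchanging the
order of integration then leaves, for each shape and level, the overlap volume of a superlevel set.
-/
theorem lintegral_min_eq_lintegral_overlap (hf : Measurable fun p : F × Space d => f p.1 p.2)
    (t : Space d) :
    ∫⁻ p, min (f p.2 (0 - p.1)) (f p.2 (t - p.1)) ∂((volume : Measure (Space d)).prod Q) =
      ∫⁻ q, overlap {x | ENNReal.ofReal q.2 < f q.1 x} t
        ∂(Q.prod ((volume : Measure ℝ).restrict (Set.Ioi 0))) := by
  have hT := measurableSet_exceedSet hf t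
  have hs : ∀ s : Space d, Measurable fun p : Space d × F => f p.2 (s - p.1) := fun s =>
    hf.comp (g := fun p : F × Space d => f p.1 p.2)
      (by fun_prop : Measurable fun p : Space d × F => (p.2, s - p.1))
  have h1 := Measure.prod_apply_symm (μ := (volume : Measure (Space d)))
    (ν := Q.prod ((volume : Measure ℝ).restrict (Set.Ioi 0))) hT
  have h2 := Measure.prod_apply (μ := (volume : Measure (Space d)))
    (ν := Q.prod ((volume : Measure ℝ).restrict (Set.Ioi 0))) hT
  rw [lintegral_prod _ ((hs 0).min (hs t)).aemeasurable]
  refine Eq.trans (lintegral_congr fun z => ?_) (h2.symm.trans h1)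
  rw [Measure.prod_apply (measurable_prodMk_left hT)]
  refine lintegral_congr fun φ => ?_
  rw [← volume_pos_ofReal_lt (min (f φ (0 - z)) (f φ (t - z))), Measure.restrict_apply
    (measurable_prodMk_left (measurable_prodMk_left hT))]
  congr 1
  ext y
  simp [exceedSet, and_comm]

theorem measurable_overlap (hf : Measurable fun p : F × Space d => f p.1 p.2) (t : Space d) :
    Measurable fun q : F × ℝ => overlap {x | ENNReal.ofReal q.2 < f q.1 x} t :=
  measurable_measure_prodMk_right (μ := (volume : Measure (Space d)))
    (measurableSet_exceedSet hf t)

end M3r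

/-- The inequality for overlaps is linear, so it passes to the mixture over shapes and levels. The
integrals are finite since `max` and `min` together integrate to 2, which allows the return to real
numbers. -/
theorem m3rTCF_inequality {χ : Space 3 → ℝ} (hχ : χ ∈ m3rTCF 3) {e : Space 3}
    (he : ‖e‖ = 1) :
    102 * χ ((49 / 100 : ℝ) • e) + 49 * χ ((52 / 100 : ℝ) • e) ≤
      51 * χ ((48 / 100 : ℝ) • e) + 2 * χ ((50 / 100 : ℝ) • e) + 98 * χ ((51 / 100 : ℝ) • e) := by
  obtain ⟨Ω, mΩ, P, hP, X, hX, ⟨F, mF, Q, hQ, f, hf, hmono, -, h⟩, htcf⟩ := hχ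
  set ρ := Q.prod ((volume : Measure ℝ).restrict (Set.Ioi 0)) with hρ
  set I : ℝ → ℝ≥0∞ := fun τ =>
    ∫⁻ q, overlap {x | ENNReal.ofReal q.2 < f q.1 x} (τ • e) ∂ρ with hI
  have hval : ∀ τ : ℝ, χ (τ • e) = (I τ).toReal := fun τ => by
    rw [h.eq_of_hasTCF hX htcf, lintegral_min_eq_lintegral_overlap hf]
  have hfin : ∀ τ, I τ ≠ ∞ := fun τ hc => by
    have := h.lintegral_max_add_lintegral_min 0 (τ • e)
    rw [lintegral_min_eq_lintegral_overlap hf] at this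
    change _ + I τ = 2 at this
    simp [hc] at this
  have hm := fun τ : ℝ => measurable_overlap hf (τ • e)
  have hineq : 102 * I (49 / 100) + 49 * I (52 / 100) ≤
      51 * I (48 / 100) + 2 * I (50 / 100) + 98 * I (51 / 100) := by
    simp only [hI]
    rw [← lintegral_const_mul _ (hm _), ← lintegral_const_mul _ (hm _),
      ← lintegral_const_mul _ (hm _), ← lintegral_const_mul _ (hm _),
      ← lintegral_const_mul _ (hm _), ← lintegral_add_left ((hm _).const_mul _),
      ← lintegral_add_left ((hm _).const_mul _),
      ← lintegral_add_right _ ((hm _).const_mul _)]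
    exact lintegral_mono fun q => overlap_inequality
      (fun x y hxy hy => lt_of_lt_of_le hy (hmono q.1 x y hxy)) he
  have hne : ∀ (c : ℝ≥0∞) (τ : ℝ), c ≠ ∞ → c * I τ ≠ ∞ := fun c τ hc =>
    ENNReal.mul_ne_top hc (hfin τ)
  have hreal := ENNReal.toReal_mono (ENNReal.add_ne_top.2
    ⟨ENNReal.add_ne_top.2 ⟨hne _ _ (by simp), hne _ _ (by simp)⟩, hne _ _ (by simp)⟩) hineq
  rw [ENNReal.toReal_add (hne _ _ (by simp)) (hne _ _ (by simp)),
    ENNReal.toReal_add (ENNReal.add_ne_top.2 ⟨hne _ _ (by simp), hne _ _ (by simp)⟩)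
      (hne _ _ (by simp)),
    ENNReal.toReal_add (hne _ _ (by simp)) (hne _ _ (by simp))] at hreal
  simpa [hval] using hreal

theorem chi_three_notMem_m3rTCF : chi 3 ∉ m3rTCF 3 := by
  intro h
  have he : ‖(EuclideanSpace.single 0 1 : Space 3)‖ = 1 := by simp
  have hineq := m3rTCF_inequality h he
  rw [chi_three_of_le he (by norm_num) (by norm_num), chi_three_of_ge he (by norm_num) (by norm_num),
    chi_three_of_le he (by norm_num) (by norm_num), chi_three_of_le he (by norm_num) (by norm_num),
    chi_three_of_ge he (by norm_num) (by norm_num)] at hineq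
  -- The points 0.48, 0.49, 0.50 use the branch `1 - r` of `φ_3(2r)` and 0.51, 0.52 the branch
  -- `1/(4r)`; the upward jump of `χ_3''` between them makes the rational inequality false.
  norm_num at hineq

end MaxStableTCF

theorem proposition4p10 :
    (∀ d : ℕ, 1 ≤ d →
      MaxStableTCF.chi d ∈ MaxStableTCF.radialTCF d \ MaxStableTCF.vbrTCF d) ∧
    MaxStableTCF.chi 3 ∈
      MaxStableTCF.radialTCF 3 \ (MaxStableTCF.vbrTCF 3 ∪ MaxStableTCF.m3rTCF 3) := by
  refine ⟨fun d hd => ⟨MaxStableTCF.chi_mem_radialTCF hd, MaxStableTCF.chi_notMem_vbrTCF hd⟩,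
    MaxStableTCF.chi_mem_radialTCF (by norm_num), ?_⟩
  rintro (h | h)
  · exact MaxStableTCF.chi_notMem_vbrTCF (by norm_num) h
  · exact MaxStableTCF.chi_three_notMem_m3rTCF h
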